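/- Let $\mathbb H=\mathbb R^3$ be the Heisenberg group with product $(x^1,x^2,x^3)(y^1,y^2,y^3)=(x^1+y^1,\,x^2+y^2,\,x^3+y^3+x^1y^2-x^2y^1)$; write $x^{\mathsf h}=(x^1,x^2)$, $x^{\mathsf v}=x^3$ and $\delta_r x=(rx^1,rx^2,r^2x^3)$. Let $\mathsf d$ be a distance on $\mathbb H$ with $\mathsf d(zx,zy)=\mathsf d(x,y)$ and $\mathsf d(\delta_rx,\delta_ry)=r\,\mathsf d(x,y)$ for all $x,y,z\in\mathbb H$, $r\ge 0$. Let $\overline B(x,r)$ be the closed $\mathsf d$-ball, put $\beta_{\mathsf d}=\sup_{\mathsf d(0,y)\le 1}\mathcal L^1(\{\sigma\in\mathbb R:(0,0,\sigma)\in \overline B(y,1)\})$, and let $$\mathcal S^2_{\mathsf d}(U)=\sup_{\varepsilon>0}\ \inf\Big\{\sum_{i\ge1}\beta_{\mathsf d}\,r_i^2:\ U\subseteq\bigcup_{i\ge1}\overline B(p_i,r_i),\ 0\le r_i\le\varepsilon\Big\}$$ be the $2$-dimensional spherical Hausdorff measure. Let $\alpha\in(0,1]$ and let $F:\mathbb H\to\mathbb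 R^2$ be of class $C^{1,\alpha}_{\mathsf h}$: the derivatives $X_1F,X_2F$ along the fields $X_1=\partial_1-x^2\partial_3$, $X_2=\partial_2+x^1\partial_3$ exist everywhere and the matrix $\nabla_{\mathsf h}F=(X_1F,X_2F)$ is $\alpha$-Hölder with respect to $\mathsf d$ on every bounded set. Let $p$ be nondegenerate for $F$, i.e. $\nabla_{\mathsf h}F(p)$ is invertible, and put $R(p,y)=F(y)-F(p)-\nabla_{\mathsf h}F(p)(p^{-1}y)^{\mathsf h}$. For an interval $I\subseteq\mathbb R$, a continuous $\gamma:I\to\mathbb H$ is a solution to the level set differential equation (LSDE) if for all $s,t\in I$ $$(\gamma_s^{-1}\gamma_t)^{\mathsf h}=-\nabla_{\mathsf h}F(p)^{-1}\big(R(p,\gamma_t)-R(p,\gamma_s)\big),\qquad (\gamma_s^{-1}\gamma_t)^{\mathsf v}=t-s+\mathbb E_{st},$$ where $\mathbb E:I^2\to\mathbb R$ satisfies $\sup_{s\ne t}|\mathbb E_{st}|/|t-s|^{1+\alpha}<\infty$. Then there is $\varepsilon_0>0$, depending only on $\mathsf d,\alpha,F,p$, such that for every interval $I\ni 0$ and every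 injective solution $\gamma:I\to\mathbb H$ to the LSDE with $\gamma_0=q$ and $\mathsf d(p,\gamma_t)<\varepsilon_0$ for all $t\in I$, the following hold. 1. $\gamma$ is parametrized by arc length with respect to $\mathcal S^2_{\mathsf d}$: $\mathcal S^2_{\mathsf d}(\gamma(J))=\mathcal L^1(J)$ for every $J\subseteq I$ that is closed in $I$. 2. Let $B$ be an open or closed $\mathsf d$-ball with center $p$ and radius $\varepsilon>0$ such that $\gamma(I)\cap B=F^{-1}(F(q))\cap B$. Then for every Borel set $U\subseteq B$ and every bounded Borel function $u:B\to\mathbb R$, $$\mathcal S^2_{\mathsf d}\big(F^{-1}(F(q))\cap U\big)=\int_I\chi_U(\gamma_\tau)\,d\tau,\qquad \int_{F^{-1}(F(q))\cap B}u\,d\mathcal S^2_{\mathsf d}=\int_{\{\tau\in I:\ \gamma_\tau\in B\}}u(\gamma_\tau)\,d\tau,$$ where both integrals in the second formula converge absolutely. -/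

import Mathlib

open MeasureTheory Set Filter
open scoped ENNReal Topology

/-- The Heisenberg group, i.e. `ℝ³` with coordinates `(x1, x2, x3)`. No topology or distance is
fixed on this type: it will come from an arbitrary left-invariant homogeneous distance. -/
@[ext]
structure Heis where
  x1 : ℝ
  x2 : ℝ
  x3 : ℝ

namespace Heis

/-- `(x¹,x²,x³)(y¹,y²,y³) = (x¹+y¹, x²+y², x³+y³+(x¹y²-x²y¹))`. -/
instance : Mul Heis :=
  ⟨fun x y => ⟨x.x1 + y.x1, x.x2 + y.x2, x.x3 + y.x3 + (x.x1 * y.x2 - x.x2 * y.x1)⟩⟩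

instance : One Heis := ⟨⟨0, 0, 0⟩⟩

instance : Inv Heis := ⟨fun x => ⟨-x.x1, -x.x2, -x.x3⟩⟩

theorem mul_def (x y : Heis) :
    x * y = ⟨x.x1 + y.x1, x.x2 + y.x2, x.x3 + y.x3 + (x.x1 * y.x2 - x.x2 * y.x1)⟩ := rfl

theorem one_def : (1 : Heis) = ⟨0, 0, 0⟩ := rfl

theorem inv_def (x : Heis) : x⁻¹ = ⟨-x.x1, -x.x2, -x.x3⟩ := rfl

instance : Group Heis :=
  Group.ofLeftAxioms
    (by intro x y z; ext <;> simp only [mul_def] <;> ring)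
    (by intro x; ext <;> simp [mul_def, one_def])
    (by intro x; ext <;> simp only [mul_def, inv_def, one_def] <;> ring)

/-- The intrinsic dilation `δ_r (x¹,x²,x³) = (r x¹, r x², r² x³)`. -/
def dil (r : ℝ) (x : Heis) : Heis := ⟨r * x.x1, r * x.x2, r ^ 2 * x.x3⟩

/-- The horizontal part `x ↦ (x¹, x²)`. -/
def hor (x : Heis) : Fin 2 → ℝ := ![x.x1, x.x2]

/-- The ambient distance on the Heisenberg group is left-invariant and `1`-homogeneous with
respect to the intrinsic dilations. -/
structure IsHomogeneousDistance [MetricSpace Heis] : Prop where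
  left_invariant : ∀ x y z : Heis, dist (z * x) (z * y) = dist x y
  homogeneous : ∀ (r : ℝ) (x y : Heis), 0 ≤ r → dist (dil r x) (dil r y) = r * dist x y

/-! ### Horizontal derivatives -/

section Derivatives

variable {k : ℕ}

/-- The curve `t ↦ x (t,0,0) = (x¹ + t, x², x³ - x² t)` is the integral curve through `x` of the
left-invariant field `X₁ = ∂₁ - x² ∂₃`; `X1 F x` is the derivative of `F` along it. -/
noncomputable def X1 (F : Heis → EuclideanSpace ℝ (Fin k)) (x : Heis) : EuclideanSpace ℝ (Fin k) :=
  deriv (fun t : ℝ => F (x * ⟨t, 0, 0⟩)) 0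

/-- The curve `t ↦ x (0,t,0) = (x¹, x² + t, x³ + x¹ t)` is the integral curve through `x` of the
left-invariant field `X₂ = ∂₂ + x¹ ∂₃`; `X2 F x` is the derivative of `F` along it. -/
noncomputable def X2 (F : Heis → EuclideanSpace ℝ (Fin k)) (x : Heis) : EuclideanSpace ℝ (Fin k) :=
  deriv (fun t : ℝ => F (x * ⟨0, t, 0⟩)) 0

/-- The horizontal Jacobian matrix `∇_h F(x) = (X₁F(x), X₂F(x))`, with columns `X₁F(x)`,
`X₂F(x)`. -/
noncomputable def hGrad (F : Heis → EuclideanSpace ℝ (Fin k)) (x : Heis) :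
    Matrix (Fin k) (Fin 2) ℝ :=
  Matrix.of fun i => ![X1 F x i, X2 F x i]

/-- The class `C^{1,α}_h(ℍ, ℝᵏ)`: both horizontal derivatives exist everywhere, and the horizontal
Jacobian matrix is `α`-Hölder continuous (in the Euclidean norm of its entries) on every bounded
set. -/
structure IsC1Holder [MetricSpace Heis] (α : ℝ) (F : Heis → EuclideanSpace ℝ (Fin k)) : Prop where
  differentiable_X1 : ∀ x : Heis, DifferentiableAt ℝ (fun t : ℝ => F (x * ⟨t, 0, 0⟩)) 0
  differentiable_X2 : ∀ x : Heis, DifferentiableAt ℝ (fun t : ℝ => F (x * ⟨0, t, 0⟩)) 0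
  holder : ∀ U : Set Heis, Bornology.IsBounded U → ∃ C : ℝ, ∀ x ∈ U, ∀ y ∈ U,
    √(∑ i, ∑ j, (hGrad F x i j - hGrad F y i j) ^ 2) ≤ C * dist x y ^ α

/-- The first order horizontal Taylor remainder
`R(x,y) = F(y) - F(x) - ∇_h F(x) (x⁻¹y)ʰ`. -/
noncomputable def taylorRem (F : Heis → EuclideanSpace ℝ (Fin k)) (x y : Heis) : Fin k → ℝ :=
  fun i => F y i - F x i - (hGrad F x).mulVec (hor (x⁻¹ * y)) i

end Derivatives

/-- `p` is nondegenerate for `F : ℍ → ℝ²`: the matrix `∇_h F(p)` is invertible. -/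
def IsNondegenerate (F : Heis → EuclideanSpace ℝ (Fin 2)) (p : Heis) : Prop :=
  IsUnit (hGrad F p)

/-- `γ : I → ℍ` solves the level set differential equation of `F` at `p`, with Hölder exponent
`α` (only the values of `γ` on `I` matter). -/
structure IsLSDESolution [MetricSpace Heis] (α : ℝ) (F : Heis → EuclideanSpace ℝ (Fin 2))
    (p : Heis) (I : Set ℝ) (γ : ℝ → Heis) : Prop where
  continuousOn : ContinuousOn γ I
  horizontal : ∀ s ∈ I, ∀ t ∈ I,
    hor ((γ s)⁻¹ * γ t) = -((hGrad F p)⁻¹.mulVec (taylorRem F p (γ t) - taylorRem F p (γ s)))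
  vertical : ∃ E : ℝ → ℝ → ℝ,
    (∀ s ∈ I, ∀ t ∈ I, ((γ s)⁻¹ * γ t).x3 = t - s + E s t) ∧
    ∃ C : ℝ, ∀ s ∈ I, ∀ t ∈ I, s ≠ t → |E s t| / |t - s| ^ (1 + α) ≤ C

/-! ### The `2`-dimensional spherical Hausdorff measure -/

section Spherical

variable [MetricSpace Heis]

/-- `β_d`, the largest length of the intersection of the vertical axis with a closed unit ball
whose center has distance at most `1` from the origin. -/
noncomputable def betaD : ℝ≥0∞ :=
  ⨆ (y : Heis) (_ : dist 1 y ≤ 1), volume {σ : ℝ | (⟨0, 0, σ⟩ : Heis) ∈ Metric.closedBall y 1}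

/-- The size `ε` approximation `S²_{d,ε}(U)`: the infimum of `∑ β_d r_i²` over the countable
coverings of `U` by balls of radii `r_i ≤ ε`. -/
noncomputable def sphericalPre (ε : ℝ) (U : Set Heis) : ℝ≥0∞ :=
  ⨅ (c : ℕ → Heis) (r : ℕ → ℝ) (_ : ∀ i, 0 ≤ r i ∧ r i ≤ ε)
    (_ : U ⊆ ⋃ i, Metric.closedBall (c i) (r i)), ∑' i, betaD * ENNReal.ofReal (r i ^ 2)

theorem sphericalPre_le {ε : ℝ} {U : Set Heis} (c : ℕ → Heis) (r : ℕ → ℝ)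
    (hr : ∀ i, 0 ≤ r i ∧ r i ≤ ε) (hU : U ⊆ ⋃ i, Metric.closedBall (c i) (r i)) :
    sphericalPre ε U ≤ ∑' i, betaD * ENNReal.ofReal (r i ^ 2) :=
  iInf_le_of_le c <| iInf_le_of_le r <| iInf_le_of_le hr <| iInf_le _ hU

theorem exists_cover_of_sphericalPre_lt {ε : ℝ} {U : Set Heis} {a : ℝ≥0∞}
    (h : sphericalPre ε U < a) : ∃ (c : ℕ → Heis) (r : ℕ → ℝ), (∀ i, 0 ≤ r i ∧ r i ≤ ε) ∧
      U ⊆ ⋃ i, Metric.closedBall (c i) (r i) ∧ ∑' i, betaD * ENNReal.ofReal (r i ^ 2) < a := by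
  simp only [sphericalPre, iInf_lt_iff] at h
  obtain ⟨c, r, hr, hU, h⟩ := h
  exact ⟨c, r, hr, hU, h⟩

theorem sphericalPre_mono (ε : ℝ) {U V : Set Heis} (h : U ⊆ V) :
    sphericalPre ε U ≤ sphericalPre ε V := by
  refine le_iInf fun c => le_iInf fun r => le_iInf fun hr => le_iInf fun hV => ?_
  exact sphericalPre_le c r hr (h.trans hV)

theorem sphericalPre_anti {ε ε' : ℝ} (h : ε ≤ ε') (U : Set Heis) :
    sphericalPre ε' U ≤ sphericalPre ε U := by
  refine le_iInf fun c => le_iInf fun r => le_iInf fun hr => le_iInf fun hV => ?_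
  exact sphericalPre_le c r (fun i => ⟨(hr i).1, (hr i).2.trans h⟩) hV

theorem sphericalPre_iUnion (ε : ℝ) (s : ℕ → Set Heis) :
    sphericalPre ε (⋃ n, s n) ≤ ∑' n, sphericalPre ε (s n) := by
  refine ENNReal.le_of_forall_pos_le_add fun η hη hfin => ?_
  obtain ⟨δ, hδ, hδs⟩ := ENNReal.exists_pos_sum_of_countable (ENNReal.coe_pos.2 hη).ne' ℕ
  have hlt : ∀ n, sphericalPre ε (s n) < sphericalPre ε (s n) + δ n := fun n =>
    ENNReal.lt_add_right ((ENNReal.le_tsum n).trans_lt hfin).ne (ENNReal.coe_pos.2 (hδ n)).ne'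
  choose c r hr hU hs using fun n => exists_cover_of_sphericalPre_lt (hlt n)
  have key := sphericalPre_le (ε := ε) (U := ⋃ n, s n)
    (fun m => c (Nat.unpair m).1 (Nat.unpair m).2) (fun m => r (Nat.unpair m).1 (Nat.unpair m).2)
    (fun m => hr _ _) (by
      intro x hx
      obtain ⟨n, hn⟩ := mem_iUnion.1 hx
      obtain ⟨i, hi⟩ := mem_iUnion.1 (hU n hn)
      exact mem_iUnion.2 ⟨Nat.pair n i, by simpa using hi⟩)
  refine key.trans ?_
  calc ∑' m, betaD * ENNReal.ofReal (r (Nat.unpair m).1 (Nat.unpair m).2 ^ 2)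
      = ∑' q : ℕ × ℕ, betaD * ENNReal.ofReal (r q.1 q.2 ^ 2) :=
        Nat.pairEquiv.symm.tsum_eq (fun q : ℕ × ℕ => betaD * ENNReal.ofReal (r q.1 q.2 ^ 2))
    _ = ∑' n, ∑' i, betaD * ENNReal.ofReal (r n i ^ 2) :=
        ENNReal.tsum_prod (f := fun n i => betaD * ENNReal.ofReal (r n i ^ 2))
    _ ≤ ∑' n, (sphericalPre ε (s n) + δ n) := ENNReal.tsum_le_tsum fun n => (hs n).le
    _ = ∑' n, sphericalPre ε (s n) + ∑' n, (δ n : ℝ≥0∞) := ENNReal.tsum_add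
    _ ≤ ∑' n, sphericalPre ε (s n) + η := by gcongr

/-- The spherical Hausdorff (outer) measure `S²_d(U) = sup_{ε > 0} S²_{d,ε}(U)`, defined on all
subsets `U` of the Heisenberg group. -/
noncomputable def sphericalOuter : OuterMeasure Heis where
  measureOf U := ⨆ (ε : ℝ) (_ : 0 < ε), sphericalPre ε U
  empty := by
    refine le_antisymm (iSup_le fun ε => iSup_le fun hε => ?_) bot_le
    exact (sphericalPre_le (fun _ => 1) (fun _ => 0) (fun _ => ⟨le_rfl, hε.le⟩)
      (empty_subset _)).trans (by simp)
  mono h := iSup_mono fun ε => iSup_mono fun _ => sphericalPre_mono ε h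
  iUnion_nat s _ := by
    refine iSup_le fun ε => iSup_le fun hε => (sphericalPre_iUnion ε s).trans ?_
    exact ENNReal.tsum_le_tsum fun n =>
      le_iSup₂ (f := fun (ε : ℝ) (_ : 0 < ε) => sphericalPre ε (s n)) ε hε

theorem sphericalOuter_apply (U : Set Heis) :
    sphericalOuter U = ⨆ (ε : ℝ) (_ : 0 < ε), sphericalPre ε U := rfl

theorem sphericalPre_add_le {δ ε : ℝ} (hε : 2 * ε < δ) {s t : Set Heis}
    (hst : ∀ x ∈ s, ∀ y ∈ t, δ ≤ dist x y) :
    sphericalPre ε s + sphericalPre ε t ≤ sphericalPre ε (s ∪ t) := by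
  classical
  refine le_iInf fun c => le_iInf fun r => le_iInf fun hr => le_iInf fun hU => ?_
  have aux : ∀ w : Set Heis, w ⊆ s ∪ t → sphericalPre ε w ≤ ∑' i, betaD * ENNReal.ofReal
      ((if (Metric.closedBall (c i) (r i) ∩ w).Nonempty then r i else 0) ^ 2) := by
    intro w hw
    refine sphericalPre_le c _ (fun i => ?_) (fun x hx => ?_)
    · split_ifs
      · exact hr i
      · exact ⟨le_rfl, (hr i).1.trans (hr i).2⟩
    · obtain ⟨i, hi⟩ := mem_iUnion.1 (hU (hw hx))
      refine mem_iUnion.2 ⟨i, ?_⟩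
      rw [if_pos ⟨x, hi, hx⟩]
      exact hi
  refine (add_le_add (aux s subset_union_left) (aux t subset_union_right)).trans ?_
  rw [← ENNReal.tsum_add]
  refine ENNReal.tsum_le_tsum fun i => ?_
  by_cases h1 : (Metric.closedBall (c i) (r i) ∩ s).Nonempty
  · have h2 : ¬ (Metric.closedBall (c i) (r i) ∩ t).Nonempty := by
      rintro ⟨y, hy, hyt⟩
      obtain ⟨x, hx, hxs⟩ := h1
      have h3 := hst x hxs y hyt
      have h4 := dist_triangle_right x y (c i)
      have h5 := (hr i).2
      rw [Metric.mem_closedBall] at hx hy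
      linarith
    simp [h1, h2]
  · by_cases h2 : (Metric.closedBall (c i) (r i) ∩ t).Nonempty <;> simp [h1, h2]

theorem sphericalOuter_isMetric : (sphericalOuter).IsMetric := by
  rintro s t ⟨ρ, hρ0, hρ⟩
  refine le_antisymm (measure_union_le s t) ?_
  obtain ⟨δ, hδ0, hδ⟩ : ∃ δ : ℝ, 0 < δ ∧ ∀ x ∈ s, ∀ y ∈ t, δ ≤ dist x y := by
    refine ⟨(min ρ 1).toReal, ENNReal.toReal_pos (by simp [hρ0]) (by simp), fun x hx y hy => ?_⟩
    rw [dist_edist]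
    exact ENNReal.toReal_mono (edist_ne_top x y) ((min_le_left _ _).trans (hρ x hx y hy))
  rw [sphericalOuter_apply s, sphericalOuter_apply t]
  refine ENNReal.biSup_add_biSup_le' ⟨1, one_pos⟩ ⟨1, one_pos⟩ fun ε hε ε' hε' => ?_
  have hpos : 0 < min (min ε ε') (δ / 3) := by positivity
  have h2 : 2 * min (min ε ε') (δ / 3) < δ := by
    have := min_le_right (min ε ε') (δ / 3)
    linarith
  calc sphericalPre ε s + sphericalPre ε' t
      ≤ sphericalPre (min (min ε ε') (δ / 3)) s + sphericalPre (min (min ε ε') (δ / 3)) t :=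
        add_le_add (sphericalPre_anti ((min_le_left _ _).trans (min_le_left _ _)) s)
          (sphericalPre_anti ((min_le_left _ _).trans (min_le_right _ _)) t)
    _ ≤ sphericalPre (min (min ε ε') (δ / 3)) (s ∪ t) := sphericalPre_add_le h2 hδ
    _ ≤ sphericalOuter (s ∪ t) :=
        le_iSup₂ (f := fun (ε : ℝ) (_ : 0 < ε) => sphericalPre ε (s ∪ t)) _ hpos

/-- The spherical Hausdorff measure `S²_d` as a Borel measure: the restriction of
`sphericalOuter` to the Borel sets. -/
noncomputable def sphericalMeasure [MeasurableSpace Heis] [BorelSpace Heis] : Measure Heis :=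
  sphericalOuter.toMeasure sphericalOuter_isMetric.le_caratheodory

end Spherical

end Heis

/-!
The horizontal equation of the level set differential equation says exactly that `F` is constant
along a solution `γ`. If `x` and `y` lie on a level set near the nondegenerate point `p`, the first
order Taylor formula and the invertibility of the horizontal Jacobian bound the horizontal part of
`x⁻¹ * y` by a multiple of `dist x y ^ (1 + α)`, so that `x⁻¹ * y` is almost vertical
(`Heis.exists_level_estimates`). With the vertical equation, `γ_s⁻¹ γ_t` agrees with `(0, 0, t - s)`
up to an error negligible with respect to `√|t - s|`, uniformly on the interval
(`Heis.HasUnitVerticalSpeed`, `Heis.IsLSDESolution.hasUnitVerticalSpeed`): at small scales `γ` is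
an isometric copy of the vertical axis.

This property alone gives the arc length parametrization
(`Heis.HasUnitVerticalSpeed.sphericalOuter_image`).
* A ball of small radius `r` that meets the curve has a trace on it of length at most
  `(1 + o(1)) β_d r²`, because left translation moves this trace into the vertical trace of a
  slightly larger ball. Summing over a covering bounds the spherical measure from below.
* For the bound from above, take a unit ball whose vertical trace nearly attains `β_d`. Its copies of
  radius `r` placed along the curve have traces of length about `β_d r²`. These traces need not be
  intervals, but they have a fixed proportion in an interval of length comparable to `r²`, so Vitali's
  theorem extracts disjoint ones that cover almost all parameters. The exceptional null set is
  harmless since `γ` is locally `1/2`-Hölder.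

The integral formula expresses that the spherical measure on the level set is the image under `γ` of
the Lebesgue measure. Its absolute convergence needs the interval to be bounded
(`Heis.IsLSDESolution.isBounded`): along almost vertical increments the vertical coordinate grows
geometrically when the time is doubled, while it is bounded on a ball.
-/

namespace Heis

/-! ### Comparison of homogeneous distances with an explicit gauge -/

section Gauge

theorem dil_one (r : ℝ) : dil r 1 = 1 := by
  simp [dil, one_def]

/-- The explicit homogeneous gauge `|x¹| + |x²| + √|x³|`, to which every homogeneous distance from
the identity is comparable. -/
noncomputable def gauge (x : Heis) : ℝ := |x.x1| + |x.x2| + √|x.x3|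

theorem gauge_nonneg (x : Heis) : 0 ≤ gauge x := by
  unfold gauge
  positivity

theorem gauge_dil {r : ℝ} (hr : 0 ≤ r) (x : Heis) : gauge (dil r x) = r * gauge x := by
  simp only [gauge, dil, abs_mul, abs_of_nonneg hr, abs_of_nonneg (sq_nonneg r)]
  rw [Real.sqrt_mul (sq_nonneg r), Real.sqrt_sq hr]
  ring

theorem sqrt_abs_add_le (a b : ℝ) : √|a + b| ≤ √|a| + √|b| :=
  Real.sqrt_le_iff.2 ⟨by positivity, by
    nlinarith [abs_add_le a b, Real.sq_sqrt (abs_nonneg a), Real.sq_sqrt (abs_nonneg b),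
      mul_nonneg (Real.sqrt_nonneg |a|) (Real.sqrt_nonneg |b|)]⟩

theorem sqrt_abs_mul_le (a b : ℝ) : √|a * b| ≤ |a| + |b| := by
  rw [abs_mul]
  refine Real.sqrt_le_iff.2 ⟨by positivity, ?_⟩
  nlinarith [abs_nonneg a, abs_nonneg b]

variable [MetricSpace Heis]

theorem dist_eq_dist_one (hd : IsHomogeneousDistance) (x y : Heis) :
    dist x y = dist 1 (x⁻¹ * y) := by
  rw [← hd.left_invariant x y x⁻¹, inv_mul_cancel]

theorem dist_self_mul (hd : IsHomogeneousDistance) (x y : Heis) :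
    dist x (x * y) = dist 1 y := by
  rw [dist_eq_dist_one hd, inv_mul_cancel_left]

theorem dist_one_dil (hd : IsHomogeneousDistance) {r : ℝ} (hr : 0 ≤ r) (x : Heis) :
    dist 1 (dil r x) = r * dist 1 x := by
  rw [← hd.homogeneous r 1 x hr, dil_one]

theorem dist_one_inv (hd : IsHomogeneousDistance) (x : Heis) : dist 1 x⁻¹ = dist 1 x := by
  rw [← hd.left_invariant 1 x⁻¹ x, mul_one, mul_inv_cancel, dist_comm]

theorem dist_one_mul_le (hd : IsHomogeneousDistance) (x y : Heis) :
    dist 1 (x * y) ≤ dist 1 x + dist 1 y := by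
  rw [← dist_self_mul hd x y]
  exact dist_triangle _ _ _

theorem dist_one_mk_fst (hd : IsHomogeneousDistance) (t : ℝ) :
    dist 1 (⟨t, 0, 0⟩ : Heis) = |t| * dist 1 (⟨1, 0, 0⟩ : Heis) := by
  rw [← dist_one_dil hd (abs_nonneg t)]
  rcases abs_cases t with ⟨h, _⟩ | ⟨h, _⟩
  · simp [dil, h]
  · rw [← dist_one_inv hd]
    simp [dil, h, inv_def]

theorem dist_one_mk_snd (hd : IsHomogeneousDistance) (t : ℝ) :
    dist 1 (⟨0, t, 0⟩ : Heis) = |t| * dist 1 (⟨0, 1, 0⟩ : Heis) := by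
  rw [← dist_one_dil hd (abs_nonneg t)]
  rcases abs_cases t with ⟨h, _⟩ | ⟨h, _⟩
  · simp [dil, h]
  · rw [← dist_one_inv hd]
    simp [dil, h, inv_def]

/-- The point `(0, 0, σ)` of the vertical axis, which is the centre of the group. -/
def vert (σ : ℝ) : Heis := ⟨0, 0, σ⟩

/-- On the vertical axis the distance is a multiple of the square root of the Euclidean one. -/
theorem dist_one_vert (hd : IsHomogeneousDistance) (t : ℝ) :
    dist 1 (vert t) = √|t| * dist 1 (vert 1) := by
  rw [← dist_one_dil hd (Real.sqrt_nonneg _)]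
  rcases abs_cases t with ⟨h, h'⟩ | ⟨h, h'⟩
  · rw [h]
    simp [dil, vert, Real.sq_sqrt h']
  · rw [← dist_one_inv hd, h]
    simp [dil, vert, inv_def, Real.sq_sqrt (neg_nonneg.2 h'.le)]

theorem dist_one_vert_one_pos : 0 < dist 1 (vert 1) :=
  dist_pos.2 fun h => by simpa [vert, one_def] using congrArg Heis.x3 h

/-- Every point is the product of one horizontal step in each direction and a vertical one, so the
triangle inequality bounds the distance by the gauge. -/
theorem exists_dist_one_le_gauge (hd : IsHomogeneousDistance) :
    ∃ C : ℝ, 0 < C ∧ ∀ x : Heis, dist 1 x ≤ C * gauge x := by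
  set c1 := dist 1 (⟨1, 0, 0⟩ : Heis)
  set c2 := dist 1 (⟨0, 1, 0⟩ : Heis)
  set c3 := dist 1 (vert 1) with hc3
  have h3 : 0 < c3 := dist_one_vert_one_pos
  have h1 : 0 ≤ c1 := dist_nonneg
  have h2 : 0 ≤ c2 := dist_nonneg
  refine ⟨c1 + c2 + c3, by positivity, fun x => ?_⟩
  have hx : x = (⟨x.x1, 0, 0⟩ * ⟨0, x.x2, 0⟩) * vert (x.x3 - x.x1 * x.x2) := by
    ext <;> simp [mul_def, vert]
  have e1 := dist_one_mul_le hd (⟨x.x1, 0, 0⟩ * ⟨0, x.x2, 0⟩) (vert (x.x3 - x.x1 * x.x2))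
  have e2 := dist_one_mul_le hd ⟨x.x1, 0, 0⟩ ⟨0, x.x2, 0⟩
  rw [← hx, dist_one_vert hd] at e1
  rw [dist_one_mk_fst hd, dist_one_mk_snd hd] at e2
  have e3 : √|x.x3 - x.x1 * x.x2| ≤ √|x.x3| + (|x.x1| + |x.x2|) := by
    rw [sub_eq_add_neg]
    refine (sqrt_abs_add_le _ _).trans ?_
    rw [abs_neg]
    gcongr
    exact sqrt_abs_mul_le _ _
  have e4 : √|x.x3 - x.x1 * x.x2| * c3 ≤ (√|x.x3| + (|x.x1| + |x.x2|)) * c3 := by gcongr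
  unfold gauge
  nlinarith [abs_nonneg x.x1, abs_nonneg x.x2, Real.sqrt_nonneg |x.x3|,
    mul_nonneg h1 (abs_nonneg x.x2), mul_nonneg h2 (abs_nonneg x.x1),
    mul_nonneg h1 (Real.sqrt_nonneg |x.x3|), mul_nonneg h2 (Real.sqrt_nonneg |x.x3|)]

/-- The distance from the identity is continuous in the Euclidean coordinates, although no
relation between the metric topology and the Euclidean one is assumed. -/
theorem continuous_dist_one_mk (hd : IsHomogeneousDistance) :
    Continuous fun v : ℝ × ℝ × ℝ => dist 1 (⟨v.1, v.2.1, v.2.2⟩ : Heis) := by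
  obtain ⟨C, hC, hle⟩ := exists_dist_one_le_gauge hd
  refine continuous_iff_continuousAt.2 fun v => ?_
  rw [ContinuousAt, tendsto_iff_dist_tendsto_zero]
  have hlim : Tendsto (fun w : ℝ × ℝ × ℝ => C * gauge
      ((⟨v.1, v.2.1, v.2.2⟩ : Heis)⁻¹ * ⟨w.1, w.2.1, w.2.2⟩)) (𝓝 v) (𝓝 0) := by
    have : Continuous fun w : ℝ × ℝ × ℝ => C * gauge
        ((⟨v.1, v.2.1, v.2.2⟩ : Heis)⁻¹ * ⟨w.1, w.2.1, w.2.2⟩) := by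
      simp only [gauge, mul_def, inv_def]
      fun_prop
    convert this.tendsto v using 2
    simp [gauge, one_def]
  refine squeeze_zero (fun _ => dist_nonneg) (fun w => ?_) hlim
  rw [Real.dist_eq, abs_sub_comm]
  refine le_trans ?_ (hle _)
  rw [← dist_eq_dist_one hd, dist_comm (1 : Heis), dist_comm (1 : Heis)]
  exact abs_dist_sub_le _ _ _

/-- The lower bound for the distance: it is attained, hence positive, on the compact unit sphere of
the gauge, and both sides are homogeneous. -/
theorem exists_gauge_le_dist_one (hd : IsHomogeneousDistance) :
    ∃ C : ℝ, 0 < C ∧ ∀ x : Heis, gauge x ≤ C * dist 1 x := by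
  set S : Set (ℝ × ℝ × ℝ) := {v | |v.1| + |v.2.1| + √|v.2.2| = 1} with hS
  have hcl : IsClosed S := isClosed_eq (by fun_prop) continuous_const
  have hsub : S ⊆ Metric.closedBall 0 1 := by
    rintro ⟨a, b, c⟩ h
    change |a| + |b| + √|c| = 1 at h
    have h1 := abs_nonneg a
    have h2 := abs_nonneg b
    have h3 := Real.sqrt_nonneg |c|
    have h4 : √|c| ≤ 1 := by linarith
    have h5 : |c| ≤ 1 := by simpa using h4
    rw [mem_closedBall_zero_iff]
    simp only [Prod.norm_mk, Real.norm_eq_abs]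
    exact max_le (by linarith) (max_le (by linarith) h5)
  have hcomp : IsCompact S := (isCompact_closedBall 0 1).of_isClosed_subset hcl hsub
  have hne : S.Nonempty := ⟨(1, 0, 0), by simp [hS]⟩
  obtain ⟨v, hv, hmin⟩ := hcomp.exists_isMinOn hne (continuous_dist_one_mk hd).continuousOn
  set m := dist 1 (⟨v.1, v.2.1, v.2.2⟩ : Heis) with hm
  have hmpos : 0 < m := by
    refine dist_pos.2 fun h => ?_
    have h1 : v.1 = 0 := (congrArg Heis.x1 h).symm
    have h2 : v.2.1 = 0 := (congrArg Heis.x2 h).symm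
    have h3 : v.2.2 = 0 := (congrArg Heis.x3 h).symm
    simp [hS, h1, h2, h3] at hv
  refine ⟨m⁻¹, inv_pos.2 hmpos, fun x => ?_⟩
  rcases (gauge_nonneg x).eq_or_lt with h0 | h0
  · rw [← h0]
    positivity
  have hg := gauge_dil (inv_nonneg.2 h0.le) x
  rw [inv_mul_cancel₀ h0.ne'] at hg
  have h1 : m ≤ dist 1 (dil (gauge x)⁻¹ x) :=
    hmin (show ((dil (gauge x)⁻¹ x).x1, (dil (gauge x)⁻¹ x).x2, (dil (gauge x)⁻¹ x).x3) ∈ S from hg)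
  rw [dist_one_dil hd (inv_nonneg.2 h0.le), le_inv_mul_iff₀ h0] at h1
  rw [le_inv_mul_iff₀ hmpos, mul_comm]
  exact h1

end Gauge

/-! ### The first order horizontal Taylor formula -/

section Taylor

/-- The mean value inequality along a one-parameter subgroup. -/
theorem abs_sub_sub_le_of_hasDerivAt_subgroup {e : ℝ → Heis} (he : ∀ s t, e (s + t) = e s * e t)
    {f g : Heis → ℝ} (hfg : ∀ x, HasDerivAt (fun t => f (x * e t)) (g x) 0) {z : Heis} {t m K : ℝ}
    (hK : ∀ u, |u| ≤ |t| → |g (z * e u) - m| ≤ K) :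
    |f (z * e t) - f z - t * m| ≤ K * |t| := by
  have he0 : e 0 = 1 := by simpa using he 0 0
  have hderiv : ∀ u, HasDerivAt (fun w => f (z * e w) - w * m) (g (z * e u) - m) u := by
    intro u
    have h1 : HasDerivAt (fun w => f (z * e u * e (w - u))) (g (z * e u)) u := by
      refine HasDerivAt.comp_sub_const (f := fun t => f (z * e u * e t)) u u ?_
      rw [sub_self]
      exact hfg _
    have h2 : (fun w => f (z * e u * e (w - u))) = fun w => f (z * e w) := by
      funext w
      rw [mul_assoc, ← he, add_sub_cancel]
    rw [h2] at h1
    have h3 := h1.sub ((hasDerivAt_id u).mul_const m)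
    rw [one_mul] at h3
    exact h3
  have key := Convex.norm_image_sub_le_of_norm_hasDerivWithin_le
    (f := fun w => f (z * e w) - w * m) (f' := fun u => g (z * e u) - m) (C := K)
    (s := Icc (-|t|) |t|) (x := 0) (y := t) (fun u _ => (hderiv u).hasDerivWithinAt)
    (fun u hu => hK u (abs_le.2 hu)) (convex_Icc _ _) (by simp) (abs_le.1 le_rfl)
  simp only [he0, Real.norm_eq_abs, mul_one, zero_mul, sub_zero] at key
  convert key using 2
  ring

/-- Any vertical displacement `c` is a commutator of horizontal steps of length at most `√|c|`. -/
theorem exists_two_mul_eq (c : ℝ) : ∃ s t : ℝ, 2 * (s * t) = c ∧ |s| ≤ √|c| ∧ |t| ≤ √|c| := by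
  have h0 : √(|c| / 2) ≤ √|c| := Real.sqrt_le_sqrt (by linarith [abs_nonneg c])
  have h1 : √(|c| / 2) * √(|c| / 2) = |c| / 2 := Real.mul_self_sqrt (by positivity)
  have h2 := abs_of_nonneg (Real.sqrt_nonneg (|c| / 2))
  rcases abs_cases c with ⟨h, _⟩ | ⟨h, _⟩
  · exact ⟨√(|c| / 2), √(|c| / 2), by rw [h1]; linarith, by rwa [h2], by rwa [h2]⟩
  · refine ⟨√(|c| / 2), -√(|c| / 2), ?_, by rwa [h2], by rwa [abs_neg, h2]⟩
    rw [mul_neg, h1]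
    linarith

variable [MetricSpace Heis]

/-- First order Taylor formula. The point `x * w` is reached from `x` along six horizontal segments
of length at most `gauge w`: two for the horizontal part of `w`, and the four sides of a commutator
for the rest. The first order terms of the commutator cancel. -/
theorem abs_taylor_le (hd : IsHomogeneousDistance) {f g₁ g₂ : Heis → ℝ}
    (h₁ : ∀ x, HasDerivAt (fun t => f (x * ⟨t, 0, 0⟩)) (g₁ x) 0)
    (h₂ : ∀ x, HasDerivAt (fun t => f (x * ⟨0, t, 0⟩)) (g₂ x) 0)
    {κ : ℝ} (hκ₁ : ∀ t, dist 1 (⟨t, 0, 0⟩ : Heis) ≤ κ * |t|)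
    (hκ₂ : ∀ t, dist 1 (⟨0, t, 0⟩ : Heis) ≤ κ * |t|) {x w : Heis} {K : ℝ}
    (hK₁ : ∀ z, dist x z ≤ 6 * κ * gauge w → |g₁ z - g₁ x| ≤ K)
    (hK₂ : ∀ z, dist x z ≤ 6 * κ * gauge w → |g₂ z - g₂ x| ≤ K) :
    |f (x * w) - f x - (w.x1 * g₁ x + w.x2 * g₂ x)| ≤ 6 * K * gauge w := by
  have hκ : 0 ≤ κ := by simpa using dist_nonneg.trans (hκ₁ 1)
  obtain ⟨s, t, hst, hs, ht⟩ := exists_two_mul_eq (w.x3 - w.x1 * w.x2)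
  have hg : 0 ≤ gauge w := gauge_nonneg w
  have hK : 0 ≤ K := (abs_nonneg _).trans (hK₁ x (by rw [dist_self]; positivity))
  have hc : √|w.x3 - w.x1 * w.x2| ≤ gauge w := by
    rw [sub_eq_add_neg]
    refine (sqrt_abs_add_le _ _).trans ?_
    rw [abs_neg]
    have := sqrt_abs_mul_le w.x1 w.x2
    unfold gauge
    linarith
  replace hs := hs.trans hc
  replace ht := ht.trans hc
  have ha : |w.x1| ≤ gauge w := by
    unfold gauge
    linarith [abs_nonneg w.x2, Real.sqrt_nonneg |w.x3|]
  have hb : |w.x2| ≤ gauge w := by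
    unfold gauge
    linarith [abs_nonneg w.x1, Real.sqrt_nonneg |w.x3|]
  -- Here `n` counts the segments already used, so that `dist x z` stays below `6 * κ * gauge w`.
  have step₁ : ∀ (n : ℝ) (z : Heis) (a : ℝ), |a| ≤ gauge w → n + 1 ≤ 6 →
      dist x z ≤ n * (κ * gauge w) → |f (z * ⟨a, 0, 0⟩) - f z - a * g₁ x| ≤ K * gauge w ∧
        dist x (z * ⟨a, 0, 0⟩) ≤ (n + 1) * (κ * gauge w) := by
    intro n z a ha hn hz
    have hdist : ∀ u, |u| ≤ |a| → dist x (z * ⟨u, 0, 0⟩) ≤ (n + 1) * (κ * gauge w) := by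
      intro u hu
      have h1 := dist_triangle x z (z * ⟨u, 0, 0⟩)
      rw [dist_self_mul hd z] at h1
      have h2 : κ * |u| ≤ κ * gauge w := by gcongr; exact hu.trans ha
      linarith [hκ₁ u]
    refine ⟨?_, hdist a le_rfl⟩
    refine (abs_sub_sub_le_of_hasDerivAt_subgroup (e := fun t => ⟨t, 0, 0⟩)
      (fun s t => by simp [mul_def]) h₁ (fun u hu => hK₁ _ ?_)).trans (by gcongr)
    refine (hdist u hu).trans ?_
    rw [mul_assoc]
    gcongr
  have step₂ : ∀ (n : ℝ) (z : Heis) (a : ℝ), |a| ≤ gauge w → n + 1 ≤ 6 →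
      dist x z ≤ n * (κ * gauge w) → |f (z * ⟨0, a, 0⟩) - f z - a * g₂ x| ≤ K * gauge w ∧
        dist x (z * ⟨0, a, 0⟩) ≤ (n + 1) * (κ * gauge w) := by
    intro n z a ha hn hz
    have hdist : ∀ u, |u| ≤ |a| → dist x (z * ⟨0, u, 0⟩) ≤ (n + 1) * (κ * gauge w) := by
      intro u hu
      have h1 := dist_triangle x z (z * ⟨0, u, 0⟩)
      rw [dist_self_mul hd z] at h1
      have h2 : κ * |u| ≤ κ * gauge w := by gcongr; exact hu.trans ha
      linarith [hκ₂ u]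
    refine ⟨?_, hdist a le_rfl⟩
    refine (abs_sub_sub_le_of_hasDerivAt_subgroup (e := fun t => ⟨0, t, 0⟩)
      (fun s t => by simp [mul_def]) h₂ (fun u hu => hK₂ _ ?_)).trans (by gcongr)
    refine (hdist u hu).trans ?_
    rw [mul_assoc]
    gcongr
  obtain ⟨e1, d1⟩ := step₁ 0 x w.x1 ha (by norm_num) (by simp)
  obtain ⟨e2, d2⟩ := step₂ _ _ w.x2 hb (by norm_num) d1
  obtain ⟨e3, d3⟩ := step₁ _ _ s hs (by norm_num) d2
  obtain ⟨e4, d4⟩ := step₂ _ _ t ht (by norm_num) d3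
  obtain ⟨e5, d5⟩ := step₁ _ _ (-s) (by rwa [abs_neg]) (by norm_num) d4
  obtain ⟨e6, -⟩ := step₂ _ _ (-t) (by rwa [abs_neg]) (by norm_num) d5
  have hy : x * w = x * ⟨w.x1, 0, 0⟩ * ⟨0, w.x2, 0⟩ * ⟨s, 0, 0⟩ * ⟨0, t, 0⟩ * ⟨-s, 0, 0⟩ *
      ⟨0, -t, 0⟩ := by
    simp only [mul_assoc]
    congr 1
    ext
    · simp [mul_def]
    · simp [mul_def]
    · simp [mul_def]
      linarith
  rw [← hy] at e6
  rw [abs_le] at *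
  constructor <;> linarith [e1.1, e1.2, e2.1, e2.2, e3.1, e3.2, e4.1, e4.2, e5.1, e5.2, e6.1, e6.2]

/-- The Taylor formula for the components of a map of class `C^{1,α}_h` near a point. -/
theorem IsC1Holder.exists_taylor (hd : IsHomogeneousDistance) {k : ℕ} {α : ℝ} (hα : 0 < α)
    {F : Heis → EuclideanSpace ℝ (Fin k)} (hF : IsC1Holder α F) (p : Heis) :
    ∃ C : ℝ, 0 < C ∧ ∀ x, dist p x < 1 →
      (∀ i j, |hGrad F x i j - hGrad F p i j| ≤ C * dist p x ^ α) ∧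
      ∀ y, dist p y < 1 → ∀ i, |F y i - F x i -
        ((x⁻¹ * y).x1 * hGrad F x i 0 + (x⁻¹ * y).x2 * hGrad F x i 1)| ≤ C * dist x y ^ (1 + α) := by
  -- All auxiliary points of the Taylor formula for `x`, `y` in the unit ball around `p` stay in the
  -- ball of radius `1 + 6 * κ * (A * 2)`.
  obtain ⟨A, hA, hgA⟩ := exists_gauge_le_dist_one hd
  set κ := max (dist 1 (⟨1, 0, 0⟩ : Heis)) (dist 1 (⟨0, 1, 0⟩ : Heis)) with hκ
  have hκ0 : 0 ≤ κ := dist_nonneg.trans (le_max_left _ _)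
  obtain ⟨C₀, hC₀⟩ :=
    hF.holder (Metric.closedBall p (1 + 6 * κ * (A * 2))) Metric.isBounded_closedBall
  set C := max C₀ 0
  have hC : 0 ≤ C := le_max_right _ _
  have hR : 1 ≤ 1 + 6 * κ * (A * 2) := by
    have : 0 ≤ 6 * κ * (A * 2) := by positivity
    linarith
  have hgrad : ∀ x ∈ Metric.closedBall p (1 + 6 * κ * (A * 2)),
      ∀ y ∈ Metric.closedBall p (1 + 6 * κ * (A * 2)), ∀ i j,
      |hGrad F x i j - hGrad F y i j| ≤ C * dist x y ^ α := by
    intro x hx y hy i j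
    calc |hGrad F x i j - hGrad F y i j| = √((hGrad F x i j - hGrad F y i j) ^ 2) :=
          (Real.sqrt_sq_eq_abs _).symm
      _ ≤ √(∑ i, ∑ j, (hGrad F x i j - hGrad F y i j) ^ 2) := by
          refine Real.sqrt_le_sqrt ?_
          refine (Finset.single_le_sum (f := fun j => (hGrad F x i j - hGrad F y i j) ^ 2)
            (fun _ _ => sq_nonneg _) (Finset.mem_univ j)).trans ?_
          exact Finset.single_le_sum (f := fun i => ∑ j, (hGrad F x i j - hGrad F y i j) ^ 2)
            (fun _ _ => Finset.sum_nonneg fun _ _ => sq_nonneg _) (Finset.mem_univ i)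
      _ ≤ C₀ * dist x y ^ α := hC₀ x hx y hy
      _ ≤ C * dist x y ^ α := by gcongr; exact le_max_left _ _
  set D := 6 * (C * (6 * κ * A) ^ α) * A with hD
  have hD0 : 0 ≤ D := by positivity
  refine ⟨C + D + 1, by positivity, fun x hx => ⟨fun i j => ?_, fun y hy i => ?_⟩⟩
  · have hx' : x ∈ Metric.closedBall p (1 + 6 * κ * (A * 2)) := by
      rw [Metric.mem_closedBall, dist_comm]
      linarith
    rw [dist_comm p x]
    refine (hgrad x hx' p (Metric.mem_closedBall_self (by linarith)) i j).trans ?_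
    gcongr
    linarith
  · set w := x⁻¹ * y with hw
    have hyw : y = x * w := by rw [hw, mul_inv_cancel_left]
    have hgw : gauge w ≤ A * dist x y := by
      rw [dist_eq_dist_one hd]
      exact hgA _
    have hxy : dist x y ≤ 2 := by
      have := dist_triangle_left x y p
      linarith
    have hK : ∀ j z, dist x z ≤ 6 * κ * gauge w →
        |hGrad F z i j - hGrad F x i j| ≤ C * (6 * κ * (A * dist x y)) ^ α := by
      intro j z hz
      have h1 : 6 * κ * gauge w ≤ 6 * κ * (A * dist x y) := by gcongr
      have h2 : 6 * κ * (A * dist x y) ≤ 6 * κ * (A * 2) := by gcongr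
      have h3 := dist_triangle p x z
      refine (hgrad z ?_ x ?_ i j).trans ?_
      · rw [Metric.mem_closedBall, dist_comm]
        linarith
      · rw [Metric.mem_closedBall, dist_comm]
        linarith
      · rw [dist_comm]
        gcongr
        exact hz.trans h1
    have key := abs_taylor_le hd (f := fun x => F x i) (g₁ := fun x => hGrad F x i 0)
      (g₂ := fun x => hGrad F x i 1) (κ := κ) (x := x) (w := w)
      (fun z => ?_) (fun z => ?_) (fun t => ?_) (fun t => ?_) (hK 0) (hK 1)
    · rw [← hyw] at key
      refine key.trans ?_
      calc 6 * (C * (6 * κ * (A * dist x y)) ^ α) * gauge w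
          ≤ 6 * (C * (6 * κ * (A * dist x y)) ^ α) * (A * dist x y) := by gcongr
        _ = D * dist x y ^ (1 + α) := by
            rw [← mul_assoc (6 * κ), Real.mul_rpow (by positivity) dist_nonneg,
              Real.rpow_add_of_nonneg dist_nonneg zero_le_one hα.le, Real.rpow_one, hD]
            ring
        _ ≤ (C + D + 1) * dist x y ^ (1 + α) := by
            gcongr
            linarith
    · exact (EuclideanSpace.proj i).hasFDerivAt.comp_hasDerivAt (0 : ℝ)
        (hF.differentiable_X1 z).hasDerivAt
    · exact (EuclideanSpace.proj i).hasFDerivAt.comp_hasDerivAt (0 : ℝ)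
        (hF.differentiable_X2 z).hasDerivAt
    · rw [dist_one_mk_fst hd, mul_comm]
      gcongr
      exact le_max_left _ _
    · rw [dist_one_mk_snd hd, mul_comm]
      gcongr
      exact le_max_right _ _

theorem IsC1Holder.continuous (hd : IsHomogeneousDistance) {k : ℕ} {α : ℝ} (hα : 0 < α)
    {F : Heis → EuclideanSpace ℝ (Fin k)} (hF : IsC1Holder α F) : Continuous F := by
  refine continuous_iff_continuousAt.2 fun x => ?_
  obtain ⟨C, hC, h⟩ := hF.exists_taylor hd hα x
  obtain ⟨A, hA, hgA⟩ := exists_gauge_le_dist_one hd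
  have hx := (h x (by simp)).2
  suffices ∀ i, Tendsto (fun y => F y i) (𝓝 x) (𝓝 (F x i)) by
    have h2 : ContinuousAt (fun y => (WithLp.ofLp (F y))) x := tendsto_pi_nhds.2 this
    exact (PiLp.continuous_toLp 2 _).continuousAt.comp h2
  intro i
  rw [tendsto_iff_dist_tendsto_zero]
  have hlim : Tendsto (fun y => C * dist x y ^ (1 + α) +
      A * dist x y * (|hGrad F x i 0| + |hGrad F x i 1|)) (𝓝 x) (𝓝 0) := by
    have : Continuous (fun y => C * dist x y ^ (1 + α) +
      A * dist x y * (|hGrad F x i 0| + |hGrad F x i 1|)) := by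
      have h1 : Continuous fun y => dist x y ^ (1 + α) :=
        (continuous_const.dist continuous_id).rpow_const fun _ => Or.inr (by linarith)
      fun_prop
    have h0 := this.tendsto x
    simpa [Real.zero_rpow (by linarith : 1 + α ≠ 0)] using h0
  refine squeeze_zero' (Eventually.of_forall fun _ => dist_nonneg) ?_ hlim
  filter_upwards [Metric.ball_mem_nhds x one_pos] with y hy
  rw [Metric.mem_ball, dist_comm] at hy
  have h1 := hx y hy i
  have h2 := hgA (x⁻¹ * y)
  rw [← dist_eq_dist_one hd] at h2
  have ha : |(x⁻¹ * y).x1| ≤ gauge (x⁻¹ * y) := by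
    unfold gauge
    linarith [abs_nonneg (x⁻¹ * y).x2, Real.sqrt_nonneg |(x⁻¹ * y).x3|]
  have hb : |(x⁻¹ * y).x2| ≤ gauge (x⁻¹ * y) := by
    unfold gauge
    linarith [abs_nonneg (x⁻¹ * y).x1, Real.sqrt_nonneg |(x⁻¹ * y).x3|]
  have h3 : |(x⁻¹ * y).x1 * hGrad F x i 0 + (x⁻¹ * y).x2 * hGrad F x i 1| ≤
      A * dist x y * (|hGrad F x i 0| + |hGrad F x i 1|) := by
    refine (abs_add_le _ _).trans ?_
    rw [abs_mul, abs_mul, mul_add]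
    gcongr
    · exact ha.trans h2
    · exact hb.trans h2
  rw [Real.dist_eq]
  have h4 := abs_add_le (F y i - F x i -
    ((x⁻¹ * y).x1 * hGrad F x i 0 + (x⁻¹ * y).x2 * hGrad F x i 1))
    ((x⁻¹ * y).x1 * hGrad F x i 0 + (x⁻¹ * y).x2 * hGrad F x i 1)
  rw [sub_add_cancel] at h4
  linarith

end Taylor

/-! ### Level sets near a nondegenerate point -/

section LevelSet

theorem exists_pos_mul_rpow_le {α : ℝ} (hα : 0 < α) (B : ℝ) {η : ℝ} (hη : 0 < η) :
    ∃ δ : ℝ, 0 < δ ∧ ∀ x, 0 ≤ x → x ≤ δ → B * x ^ α ≤ η := by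
  have hB : 0 < |B| + 1 := by positivity
  refine ⟨(η / (|B| + 1)) ^ α⁻¹, by positivity, fun x hx hxδ => ?_⟩
  have h1 : x ^ α ≤ η / (|B| + 1) := by
    calc x ^ α ≤ ((η / (|B| + 1)) ^ α⁻¹) ^ α := by gcongr
      _ = η / (|B| + 1) := Real.rpow_inv_rpow (by positivity) hα.ne'
  calc B * x ^ α ≤ (|B| + 1) * (η / (|B| + 1)) := by
        gcongr
        linarith [le_abs_self B]
    _ = η := by field_simp

/-- The sum of the absolute values of the horizontal coordinates. -/
def horAbs (x : Heis) : ℝ := |x.x1| + |x.x2|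

theorem horAbs_nonneg (x : Heis) : 0 ≤ horAbs x := by
  unfold horAbs
  positivity

/-- An invertible `2 × 2` matrix is bounded below on the horizontal layer. -/
theorem exists_horAbs_le {M : Matrix (Fin 2) (Fin 2) ℝ} (hM : IsUnit M) :
    ∃ N : ℝ, 0 < N ∧ ∀ (w : Heis) (b : ℝ), (∀ i, |w.x1 * M i 0 + w.x2 * M i 1| ≤ b) →
      horAbs w ≤ N * b := by
  have hinv : M⁻¹ * M = 1 := Matrix.nonsing_inv_mul M ((Matrix.isUnit_iff_isUnit_det M).1 hM)
  refine ⟨|M⁻¹ 0 0| + |M⁻¹ 0 1| + |M⁻¹ 1 0| + |M⁻¹ 1 1| + 1, by positivity, fun w b hb => ?_⟩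
  have hb0 : 0 ≤ b := (abs_nonneg _).trans (hb 0)
  have e : ∀ i j, M⁻¹ i 0 * M 0 j + M⁻¹ i 1 * M 1 j = (1 : Matrix (Fin 2) (Fin 2) ℝ) i j := by
    intro i j
    rw [← hinv, Matrix.mul_apply, Fin.sum_univ_two]
  have e00 := e 0 0
  have e01 := e 0 1
  have e10 := e 1 0
  have e11 := e 1 1
  simp only [Matrix.one_apply_eq] at e00 e11
  rw [Matrix.one_apply_ne (by decide)] at e01 e10
  have h1 : w.x1 = M⁻¹ 0 0 * (w.x1 * M 0 0 + w.x2 * M 0 1) +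
      M⁻¹ 0 1 * (w.x1 * M 1 0 + w.x2 * M 1 1) := by
    linear_combination -w.x1 * e00 - w.x2 * e01
  have h2 : w.x2 = M⁻¹ 1 0 * (w.x1 * M 0 0 + w.x2 * M 0 1) +
      M⁻¹ 1 1 * (w.x1 * M 1 0 + w.x2 * M 1 1) := by
    linear_combination -w.x1 * e10 - w.x2 * e11
  have key : ∀ a c : ℝ, |a * (w.x1 * M 0 0 + w.x2 * M 0 1) + c * (w.x1 * M 1 0 + w.x2 * M 1 1)| ≤
      (|a| + |c|) * b := by
    intro a c
    refine (abs_add_le _ _).trans ?_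
    rw [abs_mul, abs_mul, add_mul]
    gcongr
    · exact hb 0
    · exact hb 1
  have k1 := key (M⁻¹ 0 0) (M⁻¹ 0 1)
  have k2 := key (M⁻¹ 1 0) (M⁻¹ 1 1)
  rw [← h1] at k1
  rw [← h2] at k2
  unfold horAbs
  linarith

/-- On almost vertical increments the vertical component is superadditive up to a constant
factor, because the cocycle of the group law only sees horizontal components. -/
theorem vertical_mul_ge {x y : Heis} (hx : horAbs x ≤ 1 / 2 * √|x.x3|)
    (hy : horAbs y ≤ 1 / 2 * √|y.x3|) (hx0 : 0 ≤ x.x3) (hy0 : 0 ≤ y.x3) :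
    3 / 4 * (x.x3 + y.x3) ≤ (x * y).x3 := by
  rw [abs_of_nonneg hx0] at hx
  rw [abs_of_nonneg hy0] at hy
  have h1 : |x.x1 * y.x2 - x.x2 * y.x1| ≤ horAbs x * horAbs y := by
    refine (abs_sub _ _).trans ?_
    rw [abs_mul, abs_mul]
    unfold horAbs
    nlinarith [mul_nonneg (abs_nonneg x.x1) (abs_nonneg y.x1),
      mul_nonneg (abs_nonneg x.x2) (abs_nonneg y.x2)]
  have h2 : horAbs x * horAbs y ≤ (1 / 2 * √x.x3) * (1 / 2 * √y.x3) :=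
    mul_le_mul hx hy (horAbs_nonneg y) (by positivity)
  have h3 := Real.sq_sqrt hx0
  have h4 := Real.sq_sqrt hy0
  have h5 := (abs_le.1 h1).1
  simp only [mul_def]
  nlinarith [sq_nonneg (√x.x3 - √y.x3)]

variable [MetricSpace Heis]

/-- Near a nondegenerate point, two points of the same level set differ by an almost vertical
element: its horizontal part is of higher order than the distance, which is therefore controlled by
the square root of the vertical part. -/
theorem exists_level_estimates (hd : IsHomogeneousDistance) {α : ℝ} (hα : 0 < α)
    {F : Heis → EuclideanSpace ℝ (Fin 2)} (hF : IsC1Holder α F) {p : Heis}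
    (hp : IsNondegenerate F p) :
    ∃ ε₀ C : ℝ, 0 < ε₀ ∧ 0 < C ∧ ∀ x y, dist p x < ε₀ → dist p y < ε₀ → F x = F y →
      horAbs (x⁻¹ * y) ≤ C * dist x y ^ (1 + α) ∧ dist x y ≤ C * √|(x⁻¹ * y).x3| ∧
      horAbs (x⁻¹ * y) ≤ 1 / 2 * √|(x⁻¹ * y).x3| := by
  obtain ⟨C₁, hC₁, hle⟩ := exists_dist_one_le_gauge hd
  obtain ⟨N, hN, hinv⟩ := exists_horAbs_le hp
  obtain ⟨C, hC, htay⟩ := hF.exists_taylor hd hα p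
  set C₂ := 2 * (N * C) with hC₂
  -- On the ball of radius `δ₁` the variation of the Jacobian can be absorbed; on that of radius
  -- `δ₂ / 2` the horizontal part is at most a quarter of the distance, after normalization.
  obtain ⟨δ₁, hδ₁, h1⟩ := exists_pos_mul_rpow_le hα (N * C) (one_half_pos (α := ℝ))
  obtain ⟨δ₂, hδ₂, h2⟩ := exists_pos_mul_rpow_le hα (C₂ * C₁) (by norm_num : (0 : ℝ) < 1 / 4)
  refine ⟨min 1 (min δ₁ (δ₂ / 2)), max C₂ (2 * C₁), by positivity, by positivity,
    fun x y hx hy hxy => ?_⟩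
  simp only [lt_min_iff] at hx hy
  set w := x⁻¹ * y with hw
  set D := dist x y with hD
  have hD0 : 0 ≤ D := dist_nonneg
  have hh0 := horAbs_nonneg w
  obtain ⟨hgrad, htx⟩ := htay x hx.1
  have htxy := htx y hy.1
  have hDδ : D ≤ δ₂ := by
    have := dist_triangle_left x y p
    linarith
  have hpow : D ^ (1 + α) = D * D ^ α := by
    rw [Real.rpow_add_of_nonneg hD0 zero_le_one hα.le, Real.rpow_one]
  -- The Taylor formula at `x`, with the Jacobian at `x` replaced by the one at `p`.
  have hM : ∀ i, |w.x1 * hGrad F p i 0 + w.x2 * hGrad F p i 1| ≤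
      C * D ^ (1 + α) + C * dist p x ^ α * horAbs w := by
    intro i
    have t1 := htxy i
    rw [← hxy, sub_self, zero_sub, abs_neg] at t1
    have t2 : |w.x1 * (hGrad F x i 0 - hGrad F p i 0) + w.x2 * (hGrad F x i 1 - hGrad F p i 1)| ≤
        C * dist p x ^ α * horAbs w := by
      refine (abs_add_le _ _).trans ?_
      rw [abs_mul, abs_mul, horAbs, mul_add, mul_comm |w.x1|, mul_comm |w.x2|]
      gcongr
      · exact hgrad i 0
      · exact hgrad i 1
    rw [abs_le] at t1 t2 ⊢
    constructor <;> linarith [t1.1, t1.2, t2.1, t2.2]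
  have h3 := hinv w _ hM
  have h4 : N * C * dist p x ^ α ≤ 1 / 2 := h1 _ dist_nonneg hx.2.1.le
  have h5 : horAbs w ≤ C₂ * D ^ (1 + α) := by
    have h6 : N * C * dist p x ^ α * horAbs w ≤ 1 / 2 * horAbs w := by gcongr
    rw [hC₂]
    linarith
  have h6 := h2 D hD0 hDδ
  have h7 : D ≤ C₁ * (horAbs w + √|w.x3|) := by
    have := hle w
    rwa [hw, ← dist_eq_dist_one hd] at this
  have h8 : C₁ * horAbs w ≤ 1 / 4 * D := by
    calc C₁ * horAbs w ≤ C₁ * (C₂ * D ^ (1 + α)) := by gcongr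
      _ = C₂ * C₁ * D ^ α * D := by rw [hpow]; ring
      _ ≤ 1 / 4 * D := by gcongr
  have h9 : D ≤ 2 * C₁ * √|w.x3| := by linarith
  refine ⟨h5.trans ?_, h9.trans ?_, ?_⟩
  · gcongr
    exact le_max_left _ _
  · gcongr
    exact le_max_right _ _
  · have h10 : C₁ * horAbs w ≤ C₁ * (1 / 2 * √|w.x3|) := by linarith
    exact le_of_mul_le_mul_left h10 hC₁

end LevelSet

/-! ### Solutions of the level set differential equation -/

section Curve

variable [MetricSpace Heis]

/-- The horizontal equation says precisely that a solution stays on a level set of `F`. -/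
theorem IsLSDESolution.eq_of_mem {α : ℝ} {F : Heis → EuclideanSpace ℝ (Fin 2)} {p : Heis}
    (hp : IsNondegenerate F p) {I : Set ℝ} {γ : ℝ → Heis} (hγ : IsLSDESolution α F p I γ) {s t : ℝ}
    (hs : s ∈ I) (ht : t ∈ I) : F (γ s) = F (γ t) := by
  have hdet := (Matrix.isUnit_iff_isUnit_det _).1 hp
  have h1 := congrArg (hGrad F p).mulVec (hγ.horizontal s hs t ht)
  rw [Matrix.mulVec_neg, Matrix.mulVec_mulVec, Matrix.mul_nonsing_inv _ hdet,
    Matrix.one_mulVec] at h1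
  have h2 : hor ((γ s)⁻¹ * γ t) = hor (p⁻¹ * γ t) - hor (p⁻¹ * γ s) := by
    ext i
    fin_cases i <;> simp [hor, mul_def, inv_def] <;> ring
  rw [h2, Matrix.mulVec_sub] at h1
  ext i
  have h3 := congrFun h1 i
  simp only [Pi.sub_apply, Pi.neg_apply, taylorRem] at h3
  linarith

/-- A curve on a set `I` of parameters has unit vertical speed if, uniformly on `I`, the increment
`γ_s⁻¹ γ_t` differs from `(0, 0, t - s)` by an element whose size is negligible with respect to
`√|t - s|`, the distance scale of `(0, 0, t - s)`. -/
def HasUnitVerticalSpeed (I : Set ℝ) (γ : ℝ → Heis) : Prop :=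
  ∀ η : ℝ, 0 < η → ∃ τ : ℝ, 0 < τ ∧ ∀ s ∈ I, ∀ t ∈ I, |t - s| ≤ τ →
    dist ((γ s)⁻¹ * γ t) (vert (t - s)) ≤ η * √|t - s|

theorem IsLSDESolution.exists_abs_vertical_le {α : ℝ}
    {F : Heis → EuclideanSpace ℝ (Fin 2)} {p : Heis} {I : Set ℝ} {γ : ℝ → Heis}
    (hγ : IsLSDESolution α F p I γ) : ∃ C : ℝ, 0 < C ∧ ∀ s ∈ I, ∀ t ∈ I,
      |((γ s)⁻¹ * γ t).x3 - (t - s)| ≤ C * |t - s| ^ α * |t - s| := by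
  obtain ⟨E, hE, C, hC⟩ := hγ.vertical
  refine ⟨|C| + 1, by positivity, fun s hs t ht => ?_⟩
  rcases eq_or_ne s t with rfl | hst
  · simp [one_def]
  · have h0 : 0 < |t - s| := abs_pos.2 (sub_ne_zero.2 hst.symm)
    have h1 := hC s hs t ht hst
    rw [div_le_iff₀ (by positivity), Real.rpow_add h0, Real.rpow_one] at h1
    rw [hE s hs t ht, add_sub_cancel_left]
    refine h1.trans ?_
    have : C * (|t - s| * |t - s| ^ α) ≤ (|C| + 1) * (|t - s| * |t - s| ^ α) := by
      gcongr
      linarith [le_abs_self C]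
    linarith

theorem IsLSDESolution.hasUnitVerticalSpeed (hd : IsHomogeneousDistance) {α : ℝ} (hα : 0 < α)
    {F : Heis → EuclideanSpace ℝ (Fin 2)} {p : Heis} {I : Set ℝ} {γ : ℝ → Heis}
    (hγ : IsLSDESolution α F p I γ) {C : ℝ} (hC : 0 < C)
    (hlev : ∀ s ∈ I, ∀ t ∈ I, horAbs ((γ s)⁻¹ * γ t) ≤ C * dist (γ s) (γ t) ^ (1 + α) ∧
      dist (γ s) (γ t) ≤ C * √|((γ s)⁻¹ * γ t).x3|) : HasUnitVerticalSpeed I γ := by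
  obtain ⟨C₁, hC₁, hle⟩ := exists_dist_one_le_gauge hd
  obtain ⟨C₂, hC₂, hv⟩ := hγ.exists_abs_vertical_le
  intro η hη
  obtain ⟨δ₁, hδ₁, h1⟩ := exists_pos_mul_rpow_le hα C₂ one_pos
  obtain ⟨δ₂, hδ₂, h2⟩ := exists_pos_mul_rpow_le (half_pos hα)
    (C₁ * (C * (C * √2) ^ (1 + α) + √C₂)) hη
  refine ⟨min δ₁ δ₂, by positivity, fun s hs t ht hst => ?_⟩
  rw [le_min_iff] at hst
  set w := (γ s)⁻¹ * γ t with hw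
  set a := |t - s| with ha
  have ha0 : 0 ≤ a := abs_nonneg _
  obtain ⟨hh, hdist⟩ := hlev s hs t ht
  have hv1 := hv s hs t ht
  have hv2 : |w.x3| ≤ 2 * a := by
    have e1 : |w.x3| ≤ |w.x3 - (t - s)| + |t - s| := by
      simpa using abs_add_le (w.x3 - (t - s)) (t - s)
    have e2 : C₂ * a ^ α * a ≤ 1 * a := by
      gcongr
      exact h1 a ha0 hst.1
    linarith
  have hsq : √a * √a = a := Real.mul_self_sqrt ha0
  have hpow : √a ^ α = a ^ (α / 2) := by
    rw [Real.sqrt_eq_rpow, ← Real.rpow_mul ha0]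
    congr 1
    ring
  have hd1 : dist (γ s) (γ t) ≤ C * √2 * √a := by
    refine hdist.trans ?_
    rw [mul_assoc, ← Real.sqrt_mul zero_le_two]
    gcongr
  have hhor : horAbs w ≤ C * (C * √2) ^ (1 + α) * a ^ (α / 2) * √a := by
    calc horAbs w ≤ C * dist (γ s) (γ t) ^ (1 + α) := hh
      _ ≤ C * (C * √2 * √a) ^ (1 + α) := by gcongr
      _ = C * (C * √2) ^ (1 + α) * a ^ (α / 2) * √a := by
          rw [Real.mul_rpow (by positivity) (by positivity),
            Real.rpow_add_of_nonneg (Real.sqrt_nonneg a) zero_le_one hα.le, Real.rpow_one, hpow]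
          ring
  have hver : √|w.x3 - (t - s)| ≤ √C₂ * a ^ (α / 2) * √a := by
    refine (Real.sqrt_le_sqrt hv1).trans ?_
    rw [Real.sqrt_mul (by positivity), Real.sqrt_mul hC₂.le]
    refine le_of_eq ?_
    congr 2
    rw [Real.sqrt_eq_rpow, ← Real.rpow_mul ha0]
    congr 1
    ring
  have hprod : (vert (t - s))⁻¹ * w = ⟨w.x1, w.x2, w.x3 - (t - s)⟩ := by
    ext <;> simp [vert, mul_def, inv_def]
    ring
  rw [dist_comm, dist_eq_dist_one hd, hprod]
  calc dist 1 (⟨w.x1, w.x2, w.x3 - (t - s)⟩ : Heis)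
      ≤ C₁ * (horAbs w + √|w.x3 - (t - s)|) := hle _
    _ ≤ C₁ * (C * (C * √2) ^ (1 + α) * a ^ (α / 2) * √a + √C₂ * a ^ (α / 2) * √a) := by gcongr
    _ = C₁ * (C * (C * √2) ^ (1 + α) + √C₂) * a ^ (α / 2) * √a := by ring
    _ ≤ η * √a := by
        gcongr
        exact h2 a ha0 hst.2

/-- A solution staying in a bounded region has a bounded interval of definition: doubling the
time multiplies the vertical component of the increment by at least `3 / 2`. -/
theorem IsLSDESolution.isBounded (hd : IsHomogeneousDistance) {α : ℝ} (hα : 0 < α)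
    {F : Heis → EuclideanSpace ℝ (Fin 2)} {p : Heis} {I : Set ℝ} (hI : I.OrdConnected)
    {γ : ℝ → Heis} (hγ : IsLSDESolution α F p I γ)
    (hlev : ∀ s ∈ I, ∀ t ∈ I, horAbs ((γ s)⁻¹ * γ t) ≤ 1 / 2 * √|((γ s)⁻¹ * γ t).x3|)
    {R : ℝ} (hR : ∀ t ∈ I, dist p (γ t) < R) : Bornology.IsBounded I := by
  obtain ⟨C₂, hC₂, hv⟩ := hγ.exists_abs_vertical_le
  obtain ⟨τ, hτ, h1⟩ := exists_pos_mul_rpow_le hα C₂ one_half_pos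
  obtain ⟨A, hA, hgA⟩ := exists_gauge_le_dist_one hd
  have hgrow : ∀ (n : ℕ) (s : ℝ), s ∈ I → s + 2 ^ n * τ ∈ I →
      (3 / 2) ^ n * (τ / 2) ≤ ((γ s)⁻¹ * γ (s + 2 ^ n * τ)).x3 := by
    intro n
    induction n with
    | zero =>
      intro s hs ht
      have e1 := hv s hs _ ht
      rw [pow_zero, one_mul, add_sub_cancel_left, abs_of_pos hτ] at e1
      have e2 : C₂ * τ ^ α * τ ≤ 1 / 2 * τ := by
        gcongr
        exact h1 τ hτ.le le_rfl
      have e3 := (abs_le.1 e1).1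
      rw [pow_zero, pow_zero, one_mul, one_mul]
      linarith
    | succ n ih =>
      intro s hs ht
      have e0 : s + 2 ^ (n + 1) * τ = s + 2 ^ n * τ + 2 ^ n * τ := by ring
      have hpos : 0 < 2 ^ n * τ := by positivity
      rw [e0] at ht ⊢
      have hm : s + 2 ^ n * τ ∈ I := hI.out hs ht ⟨by linarith, by linarith⟩
      have a1 := ih s hs hm
      have a2 := ih _ hm ht
      have hnn : (0 : ℝ) ≤ (3 / 2) ^ n * (τ / 2) := by positivity
      have a3 := vertical_mul_ge (hlev _ hs _ hm) (hlev _ hm _ ht) (hnn.trans a1) (hnn.trans a2)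
      rw [mul_assoc (γ s)⁻¹, mul_inv_cancel_left] at a3
      rw [pow_succ]
      linarith
  have hbd : ∀ s ∈ I, ∀ t ∈ I, ((γ s)⁻¹ * γ t).x3 ≤ (A * (2 * R)) ^ 2 := by
    intro s hs t ht
    have e1 := hgA ((γ s)⁻¹ * γ t)
    rw [← dist_eq_dist_one hd] at e1
    have e2 : dist (γ s) (γ t) ≤ 2 * R := by
      have := dist_triangle_left (γ s) (γ t) p
      linarith [hR s hs, hR t ht]
    have e3 : √|((γ s)⁻¹ * γ t).x3| ≤ A * (2 * R) := by
      have : A * dist (γ s) (γ t) ≤ A * (2 * R) := by gcongr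
      unfold gauge at e1
      linarith [abs_nonneg ((γ s)⁻¹ * γ t).x1, abs_nonneg ((γ s)⁻¹ * γ t).x2]
    exact (le_abs_self _).trans (Real.sqrt_le_iff.1 e3).2
  obtain ⟨n, hn⟩ := pow_unbounded_of_one_lt ((A * (2 * R)) ^ 2 / (τ / 2))
    (by norm_num : (1 : ℝ) < 3 / 2)
  rw [div_lt_iff₀ (by positivity)] at hn
  refine Metric.isBounded_iff.2 ⟨2 ^ n * τ, fun s hs t ht => ?_⟩
  by_contra! hlt
  wlog hst : s ≤ t generalizing s t
  · exact this t ht s hs (by rwa [dist_comm]) (le_of_not_ge hst)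
  rw [Real.dist_eq, abs_sub_comm, abs_of_nonneg (sub_nonneg.2 hst)] at hlt
  have hpos : 0 < 2 ^ n * τ := by positivity
  have hm : s + 2 ^ n * τ ∈ I := hI.out hs ht ⟨by linarith, by linarith⟩
  linarith [hgrow n s hs hm, hbd s hs _ hm]

end Curve

/-! ### Traces of balls on the vertical axis -/

section VerticalCut

theorem dil_vert (r σ : ℝ) : dil r (vert σ) = vert (r ^ 2 * σ) := by
  simp [dil, vert]

theorem volume_preimage_sub_right (a : ℝ) (s : Set ℝ) :
    volume ((fun t => t - a) ⁻¹' s) = volume s := by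
  simp only [sub_eq_add_neg]
  exact measure_preimage_add_right volume (-a) s

theorem volume_preimage_inv_mul {a : ℝ} (ha : 0 < a) (s : Set ℝ) :
    volume ((fun t => a⁻¹ * t) ⁻¹' s) = ENNReal.ofReal a * volume s := by
  rw [Real.volume_preimage_mul_left (inv_pos.2 ha).ne', inv_inv, abs_of_pos ha]

variable [MetricSpace Heis]

theorem dist_vert (hd : IsHomogeneousDistance) (s t : ℝ) :
    dist (vert s) (vert t) = √|t - s| * dist 1 (vert 1) := by
  rw [dist_eq_dist_one hd, ← dist_one_vert hd]
  congr 1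
  ext <;> simp [vert, mul_def, inv_def]
  ring

theorem continuous_vert (hd : IsHomogeneousDistance) : Continuous vert := by
  refine continuous_iff_continuousAt.2 fun s => ?_
  rw [ContinuousAt, tendsto_iff_dist_tendsto_zero]
  have : Continuous fun t => √|s - t| * dist 1 (vert 1) := by fun_prop
  simpa [dist_vert hd] using this.tendsto s

/-- The trace on the vertical axis of the closed ball with center `y` and radius `r`, as a set of
real numbers. -/
def vertCut (y : Heis) (r : ℝ) : Set ℝ := {σ | vert σ ∈ Metric.closedBall y r}

theorem isClosed_vertCut (hd : IsHomogeneousDistance) (y : Heis) (r : ℝ) :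
    IsClosed (vertCut y r) :=
  Metric.isClosed_closedBall.preimage (continuous_vert hd)

theorem abs_le_of_mem_vertCut (hd : IsHomogeneousDistance) {y : Heis} {r σ : ℝ} (hy : dist 1 y ≤ 1)
    (h : σ ∈ vertCut y r) : |σ| ≤ ((1 + r) / dist 1 (vert 1)) ^ 2 := by
  have h1 : dist (vert σ) y ≤ r := h
  have h2 := dist_triangle_right 1 (vert σ) y
  rw [dist_one_vert hd] at h2
  refine (Real.sqrt_le_iff.1 ?_).2
  rw [le_div_iff₀ dist_one_vert_one_pos]
  linarith

theorem vertCut_subset_closedBall (hd : IsHomogeneousDistance) {y : Heis} {r : ℝ}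
    (hy : dist 1 y ≤ 1) :
    vertCut y r ⊆ Metric.closedBall 0 (((1 + r) / dist 1 (vert 1)) ^ 2) := fun _ h =>
  mem_closedBall_zero_iff.2 (abs_le_of_mem_vertCut hd hy h)

theorem volume_vertCut_lt_top (hd : IsHomogeneousDistance) {y : Heis} {r : ℝ}
    (hy : dist 1 y ≤ 1) : volume (vertCut y r) < ⊤ :=
  (measure_mono (vertCut_subset_closedBall hd hy)).trans_lt measure_closedBall_lt_top

theorem vertCut_mem_nhds (hd : IsHomogeneousDistance) {y : Heis} {r : ℝ} (hy : dist 1 y < r) :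
    vertCut y r ∈ 𝓝 0 :=
  (continuous_vert hd).continuousAt.preimage_mem_nhds (Metric.closedBall_mem_nhds_of_mem hy)

theorem volume_vertCut_le_betaD {y : Heis} (hy : dist 1 y ≤ 1) : volume (vertCut y 1) ≤ betaD :=
  le_iSup₂ (f := fun (y : Heis) (_ : dist 1 y ≤ 1) => volume (vertCut y 1)) y hy

theorem betaD_pos (hd : IsHomogeneousDistance) : 0 < betaD :=
  (Measure.measure_pos_of_mem_nhds volume (vertCut_mem_nhds hd (y := 1) (r := 1) (by simp))).trans_le
    (volume_vertCut_le_betaD (by simp))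

theorem betaD_lt_top (hd : IsHomogeneousDistance) : betaD < ⊤ := by
  refine lt_of_le_of_lt (iSup₂_le fun y hy => ?_)
    (measure_closedBall_lt_top (μ := (volume : Measure ℝ)) (x := 0)
      (r := ((1 + 1) / dist 1 (vert 1)) ^ 2))
  exact measure_mono (vertCut_subset_closedBall hd hy)

/-- By homogeneity, `β_d` controls the vertical traces of balls of every radius. -/
theorem volume_vertCut_le (hd : IsHomogeneousDistance) {z : Heis} {r : ℝ} (hr : 0 < r)
    (hz : dist 1 z ≤ r) : volume (vertCut z r) ≤ betaD * ENNReal.ofReal (r ^ 2) := by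
  have hri : 0 ≤ r⁻¹ := (inv_pos.2 hr).le
  have h1 : vertCut z r = (fun t => (r ^ 2)⁻¹ * t) ⁻¹' vertCut (dil r⁻¹ z) 1 := by
    ext σ
    change dist (vert σ) z ≤ r ↔ dist (vert ((r ^ 2)⁻¹ * σ)) (dil r⁻¹ z) ≤ 1
    rw [← inv_pow, ← dil_vert, hd.homogeneous _ _ _ hri, inv_mul_le_iff₀ hr, mul_one]
  rw [h1, volume_preimage_inv_mul (by positivity), mul_comm]
  gcongr
  refine volume_vertCut_le_betaD ?_
  rwa [dist_one_dil hd hri, inv_mul_le_iff₀ hr, mul_one]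

end VerticalCut

/-! ### The approximating outer measures -/

section Spherical

variable [MetricSpace Heis]

/-- The size `ε` approximation of the spherical measure as an outer measure. -/
noncomputable def sphericalPreOuter (ε : ℝ) (hε : 0 ≤ ε) : OuterMeasure Heis where
  measureOf := sphericalPre ε
  empty := le_antisymm ((sphericalPre_le (fun _ => 1) (fun _ => 0) (fun _ => ⟨le_rfl, hε⟩)
    (empty_subset _)).trans (by simp)) bot_le
  mono h := sphericalPre_mono ε h
  iUnion_nat s _ := sphericalPre_iUnion ε s

theorem sphericalPre_closedBall_le {ε r : ℝ} (hr : 0 ≤ r) (hrε : r ≤ ε) (c : Heis) :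
    sphericalPre ε (Metric.closedBall c r) ≤ betaD * ENNReal.ofReal (r ^ 2) := by
  refine (sphericalPre_le (fun _ => c) (fun i => if i = 0 then r else 0) (fun i => ?_) ?_).trans ?_
  · split_ifs
    · exact ⟨hr, hrε⟩
    · exact ⟨le_rfl, hr.trans hrε⟩
  · exact fun x hx => mem_iUnion.2 ⟨0, by simpa using hx⟩
  · rw [tsum_eq_single 0 fun i hi => by simp [hi]]
    simp

theorem sphericalPre_le_sphericalOuter {ε : ℝ} (hε : 0 < ε) (U : Set Heis) :
    sphericalPre ε U ≤ sphericalOuter U :=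
  le_iSup₂ (f := fun (ε : ℝ) (_ : 0 < ε) => sphericalPre ε U) ε hε

end Spherical

/-! ### Spherical measure of curves of unit vertical speed -/

section AreaFormula

theorem le_of_forall_ofReal_mul_le {c : ℝ → ℝ} (hc : Continuous c) (hc0 : c 0 = 1)
    {a b : ℝ≥0∞} (h : ∀ η : ℝ, 0 < η → a ≤ ENNReal.ofReal (c η) * b) : a ≤ b := by
  have h1 : Tendsto (fun η => ENNReal.ofReal (c η) * b) (𝓝[>] 0) (𝓝 (ENNReal.ofReal (c 0) * b)) :=
    ENNReal.Tendsto.mul_const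
      ((ENNReal.continuous_ofReal.comp hc).continuousAt.tendsto.mono_left nhdsWithin_le_nhds)
      (Or.inl (by simp [hc0]))
  rw [hc0, ENNReal.ofReal_one, one_mul] at h1
  refine ge_of_tendsto h1 ?_
  filter_upwards [self_mem_nhdsWithin] with η hη
  exact h η hη

variable [MetricSpace Heis] {I : Set ℝ} {γ : ℝ → Heis}

theorem HasUnitVerticalSpeed.abs_dist_sub_le (hd : IsHomogeneousDistance)
    (hγ : HasUnitVerticalSpeed I γ) {η : ℝ} (hη : 0 < η) : ∃ τ : ℝ, 0 < τ ∧
      ∀ s ∈ I, ∀ t ∈ I, |t - s| ≤ τ →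
        |dist (γ s) (γ t) - √|t - s| * dist 1 (vert 1)| ≤ η * √|t - s| := by
  obtain ⟨τ, hτ, h⟩ := hγ η hη
  refine ⟨τ, hτ, fun s hs t ht hst => le_trans ?_ (h s hs t ht hst)⟩
  rw [dist_eq_dist_one hd, ← dist_one_vert hd, dist_comm 1, dist_comm 1]
  exact _root_.abs_dist_sub_le _ _ _

/-- A curve of unit vertical speed is locally `1/2`-Hölder, so it maps Lebesgue null sets to sets
that are negligible for the `2`-dimensional measure. -/
theorem HasUnitVerticalSpeed.sphericalOuter_image_null (hd : IsHomogeneousDistance)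
    (hγ : HasUnitVerticalSpeed I γ) {N : Set ℝ} (hN : N ⊆ I) (h0 : volume N = 0) :
    sphericalOuter (γ '' N) = 0 := by
  obtain ⟨τ, hτ, hdist⟩ := hγ.abs_dist_sub_le hd one_pos
  set M := dist 1 (vert 1) + 1 with hM
  have hM0 : 0 < M := by positivity
  have hHol : ∀ s ∈ I, ∀ t ∈ I, |t - s| ≤ τ → dist (γ s) (γ t) ≤ M * √|t - s| := by
    intro s hs t ht hst
    have := (abs_le.1 (hdist s hs t ht hst)).2
    rw [hM]
    linarith
  refine le_antisymm (iSup₂_le fun ε hε => ?_) bot_le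
  have hβ := betaD_lt_top hd
  set a := betaD * ENNReal.ofReal (M ^ 2) with ha
  have hatop : a ≠ ⊤ := ENNReal.mul_ne_top hβ.ne ENNReal.ofReal_ne_top
  refine ENNReal.le_of_forall_pos_le_add fun δ hδ _ => ?_
  rw [zero_add]
  set ρ := min τ ((ε / M) ^ 2) with hρ
  have hρ0 : 0 < ρ := by positivity
  rw [← hausdorffMeasure_real, Measure.hausdorffMeasure_apply] at h0
  have h1 := (le_iSup₂ (f := fun (r : ℝ≥0∞) (_ : 0 < r) =>
    ⨅ (t : ℕ → Set ℝ) (_ : N ⊆ ⋃ n, t n) (_ : ∀ n, Metric.ediam (t n) ≤ r),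
      ∑' n, ⨆ _ : (t n).Nonempty, Metric.ediam (t n) ^ (1 : ℝ)) (ENNReal.ofReal ρ)
      (ENNReal.ofReal_pos.2 hρ0)).trans h0.le
  have h2 := h1.trans_lt (ENNReal.div_pos (ENNReal.coe_pos.2 hδ).ne' hatop)
  simp only [iInf_lt_iff] at h2
  obtain ⟨T, hT, hdiam, hsum⟩ := h2
  have hpiece : ∀ n, sphericalPre ε (γ '' (N ∩ T n)) ≤
      a * ⨆ _ : (T n).Nonempty, Metric.ediam (T n) ^ (1 : ℝ) := by
    intro n
    rcases (N ∩ T n).eq_empty_or_nonempty with he | ⟨s, hsN, hsT⟩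
    · rw [he, image_empty]
      exact ((sphericalPreOuter ε hε.le).empty).le.trans bot_le
    have hne : (T n).Nonempty := ⟨s, hsT⟩
    have hfin : Metric.ediam (T n) ≠ ⊤ := ((hdiam n).trans_lt ENNReal.ofReal_lt_top).ne
    set d := (Metric.ediam (T n)).toReal with hd'
    have hd0 : 0 ≤ d := ENNReal.toReal_nonneg
    have hdρ : d ≤ ρ := ENNReal.toReal_le_of_le_ofReal hρ0.le (hdiam n)
    have hsub : γ '' (N ∩ T n) ⊆ Metric.closedBall (γ s) (M * √d) := by
      rintro _ ⟨t, ⟨htN, htT⟩, rfl⟩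
      have hst : |t - s| ≤ d := by
        rw [← Real.dist_eq, dist_edist]
        exact ENNReal.toReal_mono hfin (Metric.edist_le_ediam_of_mem htT hsT)
      rw [Metric.mem_closedBall, dist_comm]
      refine (hHol s (hN hsN) t (hN htN) (hst.trans (hdρ.trans (min_le_left _ _)))).trans ?_
      gcongr
    have hrε : M * √d ≤ ε := by
      have : √d ≤ ε / M := Real.sqrt_le_iff.2 ⟨by positivity, hdρ.trans (min_le_right _ _)⟩
      rw [le_div_iff₀ hM0] at this
      linarith
    refine (sphericalPre_mono ε hsub).trans
      ((sphericalPre_closedBall_le (by positivity) hrε _).trans ?_)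
    rw [iSup_pos hne, ENNReal.rpow_one, mul_pow, Real.sq_sqrt hd0, ENNReal.ofReal_mul (by positivity),
      ← mul_assoc, ENNReal.ofReal_toReal hfin]
  have hcov : γ '' N ⊆ ⋃ n, γ '' (N ∩ T n) := by
    rw [← image_iUnion, ← inter_iUnion]
    exact image_mono (subset_inter le_rfl hT)
  calc sphericalPre ε (γ '' N) ≤ ∑' n, sphericalPre ε (γ '' (N ∩ T n)) :=
        (sphericalPre_mono ε hcov).trans (sphericalPre_iUnion ε _)
    _ ≤ ∑' n, a * ⨆ _ : (T n).Nonempty, Metric.ediam (T n) ^ (1 : ℝ) :=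
        ENNReal.tsum_le_tsum hpiece
    _ = a * ∑' n, ⨆ _ : (T n).Nonempty, Metric.ediam (T n) ^ (1 : ℝ) := ENNReal.tsum_mul_left
    _ ≤ a * (δ / a) := by gcongr
    _ ≤ δ := ENNReal.mul_div_le

/-- Lower bound for the spherical measure. The parameters of a compact piece of the curve that fall
into a small ball are contained in a translate of the vertical trace of a slightly larger ball, whose
length is controlled by `β_d`. Compactness makes the bound uniform over the balls of a covering. -/
theorem HasUnitVerticalSpeed.volume_le_of_isCompact (hd : IsHomogeneousDistance)
    (hγ : HasUnitVerticalSpeed I γ) (hcont : ContinuousOn γ I) (hinj : InjOn γ I) {K : Set ℝ}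
    (hK : IsCompact K) (hKI : K ⊆ I) : volume K ≤ sphericalOuter (γ '' K) := by
  set c := dist 1 (vert 1) with hc
  have hc0 : 0 < c := dist_one_vert_one_pos
  refine le_of_forall_ofReal_mul_le (c := fun η => (1 + 4 / c * η) ^ 2) (by fun_prop)
    (by simp) fun η hη => ?_
  obtain ⟨τ₁, hτ₁, hver⟩ := hγ η hη
  obtain ⟨τ₂, hτ₂, hdist⟩ := hγ.abs_dist_sub_le hd (half_pos hc0)
  -- By compactness and injectivity, nearby points of the curve have nearby parameters.
  obtain ⟨δ, hδ, hpar⟩ : ∃ δ : ℝ, 0 < δ ∧ ∀ s ∈ K, ∀ t ∈ K, dist (γ s) (γ t) < δ →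
      |t - s| ≤ min τ₁ τ₂ := by
    set P : Set (ℝ × ℝ) := (K ×ˢ K) ∩ {q | min τ₁ τ₂ ≤ |q.2 - q.1|} with hP
    have hPc : IsCompact P :=
      (hK.prod hK).inter_right (isClosed_le continuous_const (by fun_prop))
    have hPcont : ContinuousOn (fun q : ℝ × ℝ => dist (γ q.1) (γ q.2)) P := by
      refine continuous_dist.comp_continuousOn (ContinuousOn.prodMk ?_ ?_)
      · exact (hcont.mono hKI).comp continuousOn_fst fun q hq => hq.1.1
      · exact (hcont.mono hKI).comp continuousOn_snd fun q hq => hq.1.2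
    rcases P.eq_empty_or_nonempty with he | hne
    · refine ⟨1, one_pos, fun s hs t ht _ => ?_⟩
      by_contra! hlt
      have : (s, t) ∈ P := ⟨⟨hs, ht⟩, hlt.le⟩
      rw [he] at this
      exact this
    · obtain ⟨q, hq, hmin⟩ := hPc.exists_isMinOn hne hPcont
      refine ⟨dist (γ q.1) (γ q.2), dist_pos.2 fun h => ?_, fun s hs t ht hst => ?_⟩
      · have h1 := hinj (hKI hq.1.1) (hKI hq.1.2) h
        have h2 : min τ₁ τ₂ ≤ |q.2 - q.1| := hq.2
        rw [h1, sub_self, abs_zero] at h2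
        exact absurd h2 (not_le.2 (by positivity))
      · by_contra! hlt
        have h3 : (s, t) ∈ P := ⟨⟨hs, ht⟩, hlt.le⟩
        exact absurd hst (not_lt.2 (hmin h3))
  have hball : ∀ (x : Heis) (r : ℝ), 0 ≤ r → r ≤ δ / 3 →
      volume (K ∩ γ ⁻¹' Metric.closedBall x r) ≤
        ENNReal.ofReal ((1 + 4 / c * η) ^ 2) * (betaD * ENNReal.ofReal (r ^ 2)) := by
    intro x r hr hrδ
    rcases (K ∩ γ ⁻¹' Metric.closedBall x r).eq_empty_or_nonempty with he | ⟨s, hsK, hsx⟩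
    · rw [he, measure_empty]
      exact bot_le
    have hsx' : dist (γ s) x ≤ r := hsx
    have hpt : ∀ t ∈ K ∩ γ ⁻¹' Metric.closedBall x r, |t - s| ≤ min τ₁ τ₂ ∧
        √|t - s| ≤ 4 / c * r := by
      rintro t ⟨htK, htx⟩
      have htx' : dist (γ t) x ≤ r := htx
      have h1 : dist (γ s) (γ t) ≤ 2 * r := by
        have := dist_triangle_right (γ s) (γ t) x
        linarith
      have h2 := hpar s hsK t htK (by linarith)
      refine ⟨h2, ?_⟩
      have h3 := (abs_le.1 (hdist s (hKI hsK) t (hKI htK) (h2.trans (min_le_right _ _)))).1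
      rw [div_mul_eq_mul_div, le_div_iff₀ hc0]
      linarith
    -- A ball of radius zero contributes nothing to the sum, so its trace must be null.
    rcases hr.eq_or_lt with rfl | hr0
    · have hsub : K ∩ γ ⁻¹' Metric.closedBall x 0 ⊆ {s} := by
        intro t ht
        have h1 := (hpt t ht).2
        rw [mul_zero] at h1
        have h2 := Real.sqrt_eq_zero'.1 (le_antisymm h1 (Real.sqrt_nonneg _))
        have h3 := abs_nonpos_iff.1 h2
        exact mem_singleton_iff.2 (by linarith)
      exact (measure_mono hsub).trans (by simp)
    set r' := (1 + 4 / c * η) * r with hr'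
    have hle : r ≤ r' := by
      have : 0 ≤ 4 / c * η * r := by positivity
      linarith
    have hsub : K ∩ γ ⁻¹' Metric.closedBall x r ⊆
        (fun t => t - s) ⁻¹' vertCut ((γ s)⁻¹ * x) r' := by
      intro t ht
      obtain ⟨h1, h2⟩ := hpt t ht
      have h3 := hver s (hKI hsK) t (hKI ht.1) (h1.trans (min_le_left _ _))
      change dist (vert (t - s)) ((γ s)⁻¹ * x) ≤ r'
      have h4 : dist ((γ s)⁻¹ * γ t) ((γ s)⁻¹ * x) ≤ r := by
        rw [hd.left_invariant]
        exact ht.2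
      have h5 := dist_triangle_left (vert (t - s)) ((γ s)⁻¹ * x) ((γ s)⁻¹ * γ t)
      have h6 : η * √|t - s| ≤ η * (4 / c * r) := by gcongr
      rw [hr']
      linarith
    refine (measure_mono hsub).trans ?_
    rw [volume_preimage_sub_right]
    refine (volume_vertCut_le hd (by positivity) ?_).trans (le_of_eq ?_)
    · rw [← dist_eq_dist_one hd]
      exact hsx'.trans hle
    · rw [hr', mul_pow, ENNReal.ofReal_mul (by positivity)]
      ring
  refine le_trans ?_ (mul_le_mul_right (sphericalPre_le_sphericalOuter (by positivity : 0 < δ / 3) _)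
    _)
  rw [sphericalPre, ENNReal.mul_iInf_of_ne (by simp; positivity) ENNReal.ofReal_ne_top]
  refine le_iInf fun x => ?_
  rw [ENNReal.mul_iInf_of_ne (by simp; positivity) ENNReal.ofReal_ne_top]
  refine le_iInf fun r => ?_
  simp only [ENNReal.mul_iInf_of_ne (a := ENNReal.ofReal ((1 + 4 / c * η) ^ 2))
    (by simp; positivity) ENNReal.ofReal_ne_top]
  refine le_iInf fun hr => le_iInf fun hcov => ?_
  rw [← ENNReal.tsum_mul_left]
  have hsub : K ⊆ ⋃ i, K ∩ γ ⁻¹' Metric.closedBall (x i) (r i) := by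
    intro t ht
    obtain ⟨i, hi⟩ := mem_iUnion.1 (hcov (mem_image_of_mem γ ht))
    exact mem_iUnion.2 ⟨i, ht, hi⟩
  exact (measure_mono hsub).trans ((measure_iUnion_le _).trans
    (ENNReal.tsum_le_tsum fun i => hball _ _ (hr i).1 (hr i).2))

/-- Upper bound for the spherical measure. By definition of `β_d` there is a unit ball whose
vertical trace has almost maximal length; its translates and dilates give balls centered near the
curve whose traces on the curve satisfy the assumptions of the Vitali covering theorem. -/
theorem HasUnitVerticalSpeed.sphericalOuter_image_le_of_subset_interior
    (hd : IsHomogeneousDistance) (hγ : HasUnitVerticalSpeed I γ) {J : Set ℝ}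
    (hJ : J ⊆ interior I) : sphericalOuter (γ '' J) ≤ volume J := by
  rcases eq_or_ne (volume J) ⊤ with htop | hfin
  · rw [htop]
    exact le_top
  have hβ0 := betaD_pos hd
  have hβ := betaD_lt_top hd
  set c := dist 1 (vert 1) with hc
  have hc0 : 0 < c := dist_one_vert_one_pos
  refine iSup₂_le fun ε hε => ?_
  refine le_of_forall_ofReal_mul_le (c := fun η => (1 + η) * (1 + 2 * η) ^ 2) (by fun_prop)
    (by simp) fun η hη => ?_
  obtain ⟨y, hy, hyβ⟩ : ∃ y : Heis, dist 1 y ≤ 1 ∧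
      betaD ≤ ENNReal.ofReal (1 + η) * volume (vertCut y 1) := by
    have hlt : betaD / ENNReal.ofReal (1 + η) < betaD := by
      refine ENNReal.div_lt_of_lt_mul' ?_
      have h1 : (1 : ℝ≥0∞) < ENNReal.ofReal (1 + η) := ENNReal.one_lt_ofReal.2 (by linarith)
      simpa using ENNReal.mul_lt_mul_left hβ0.ne' hβ.ne h1
    conv_rhs at hlt => rw [betaD]
    simp only [lt_iSup_iff] at hlt
    obtain ⟨y, hy, hlt⟩ := hlt
    refine ⟨y, hy, ?_⟩
    rw [mul_comm]
    exact (ENNReal.div_le_iff_le_mul (Or.inl (by simp; linarith))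
      (Or.inl ENNReal.ofReal_ne_top)).1 hlt.le
  -- Enlarging the radius makes the trace a neighbourhood of `0`, as Vitali's theorem requires.
  set K := vertCut y (1 + η) with hK
  have hKcl : IsClosed K := isClosed_vertCut hd _ _
  have hKnhds : K ∈ 𝓝 (0 : ℝ) := vertCut_mem_nhds hd (by linarith)
  have hKtop : volume K ≠ ⊤ := (volume_vertCut_lt_top hd hy).ne
  have hKpos : 0 < volume K := Measure.measure_pos_of_mem_nhds volume hKnhds
  have hKβ : betaD ≤ ENNReal.ofReal (1 + η) * volume K := by
    refine hyβ.trans ?_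
    gcongr
    exact fun σ hσ => Metric.closedBall_subset_closedBall (by linarith) hσ
  set m := ((1 + (1 + η)) / c) ^ 2 with hm
  have hm0 : 0 < m := by positivity
  have hKm : ∀ σ ∈ K, |σ| ≤ m := fun σ hσ => abs_le_of_mem_vertCut hd hy hσ
  -- Inside a dilated trace `√|t - s| ≤ √m * r`, so this precision keeps the error below `η * r`.
  obtain ⟨τ, hτ, hver⟩ := hγ (η / √m) (by positivity)
  -- The trace, in the parameter space, of the vertical trace dilated by `r` and centered at `s`.
  set B : ℝ × ℝ → Set ℝ := fun a => (fun t => t - a.1) ⁻¹' ((fun t => (a.2 ^ 2)⁻¹ * t) ⁻¹' K)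
    with hB
  have hBvol : ∀ a : ℝ × ℝ, 0 < a.2 → volume (B a) = ENNReal.ofReal (a.2 ^ 2) * volume K := by
    intro a ha
    rw [hB]
    dsimp only
    rw [volume_preimage_sub_right, volume_preimage_inv_mul (by positivity)]
  have hBball : ∀ a : ℝ × ℝ, 0 < a.2 → B a ⊆ Metric.closedBall a.1 (m * a.2 ^ 2) := by
    intro a ha t ht
    have h1 : |(a.2 ^ 2)⁻¹ * (t - a.1)| ≤ m := hKm _ ht
    rw [abs_mul, abs_inv, abs_of_pos (pow_pos ha 2), inv_mul_le_iff₀ (pow_pos ha 2)] at h1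
    rw [Metric.mem_closedBall, Real.dist_eq]
    linarith
  have hBimage : ∀ a : ℝ × ℝ, 0 < a.2 → m * a.2 ^ 2 ≤ τ → a.1 ∈ I → B a ⊆ I →
      γ '' B a ⊆ Metric.closedBall (γ a.1 * dil a.2 y) ((1 + 2 * η) * a.2) := by
    rintro ⟨s, r⟩ hr hrτ hs hBI _ ⟨t, ht, rfl⟩
    dsimp only at hr hrτ hs ⊢
    have h1 : |t - s| ≤ m * r ^ 2 := by
      have := hBball (s, r) hr ht
      rwa [Metric.mem_closedBall, Real.dist_eq] at this
    have h2 := hver s hs t (hBI ht) (h1.trans hrτ)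
    have h3 : √|t - s| ≤ √m * r := by
      rw [← Real.sqrt_sq hr.le, ← Real.sqrt_mul hm0.le]
      exact Real.sqrt_le_sqrt h1
    have h4 : η / √m * √|t - s| ≤ η * r := by
      calc η / √m * √|t - s| ≤ η / √m * (√m * r) := by gcongr
        _ = η * r := by field_simp
    have h5 : dist (vert (t - s)) (dil r y) ≤ r * (1 + η) := by
      have e1 : vert (t - s) = dil r (vert ((r ^ 2)⁻¹ * (t - s))) := by
        rw [dil_vert, mul_inv_cancel_left₀ (by positivity)]
      rw [e1, hd.homogeneous _ _ _ hr.le]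
      gcongr
      exact ht
    rw [Metric.mem_closedBall, ← hd.left_invariant _ _ (γ s)⁻¹, inv_mul_cancel_left]
    have h6 := dist_triangle ((γ s)⁻¹ * γ t) (vert (t - s)) (dil r y)
    linarith
  change _ ≤ ENNReal.ofReal ((1 + η) * (1 + 2 * η) ^ 2) * volume J
  -- It suffices to compare with open neighbourhoods of `J` inside the interval.
  suffices ∀ O : Set ℝ, IsOpen O → J ⊆ O → O ⊆ interior I →
      sphericalPre ε (γ '' J) ≤ ENNReal.ofReal ((1 + η) * (1 + 2 * η) ^ 2) * volume O by
    rw [J.measure_eq_iInf_isOpen, ENNReal.mul_iInf_of_ne (by simp; positivity) ENNReal.ofReal_ne_top]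
    refine le_iInf fun O => ?_
    rw [ENNReal.mul_iInf_of_ne (by simp; positivity) ENNReal.ofReal_ne_top]
    refine le_iInf fun hJO => ?_
    rw [ENNReal.mul_iInf_of_ne (by simp; positivity) ENNReal.ofReal_ne_top]
    refine le_iInf fun hO => ?_
    refine (this (O ∩ interior I) (hO.inter isOpen_interior) (subset_inter hJO hJ)
      inter_subset_right).trans ?_
    gcongr
    exact inter_subset_left
  intro O hO hJO hOI
  set T : Set (ℝ × ℝ) := {a | a.1 ∈ J ∧ 0 < a.2 ∧ m * a.2 ^ 2 ≤ τ ∧ (1 + 2 * η) * a.2 ≤ ε ∧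
    Metric.closedBall a.1 (m * a.2 ^ 2) ⊆ O} with hT
  obtain ⟨u, huT, hucount, hudisj, hunull⟩ := Vitali.exists_disjoint_covering_ae volume J T
    (6 * m / (volume K).toReal).toNNReal (fun a => m * a.2 ^ 2) (fun a => a.1) B
    (fun a ha => hBball a ha.2.1)
    (fun a ha => by
      have hKr : 0 < (volume K).toReal := ENNReal.toReal_pos hKpos.ne' hKtop
      rw [Real.volume_closedBall, hBvol a ha.2.1]
      change _ ≤ ENNReal.ofReal (6 * m / (volume K).toReal) * _
      rw [← ENNReal.ofReal_toReal hKtop, ENNReal.toReal_ofReal hKr.le,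
        ← ENNReal.ofReal_mul (by positivity), ← ENNReal.ofReal_mul (by positivity)]
      refine ENNReal.ofReal_le_ofReal (le_of_eq ?_)
      field_simp
      ring)
    (fun a _ => by
      refine ⟨a.1, mem_interior_iff_mem_nhds.2 ?_⟩
      have hcts : ContinuousAt (fun t => (a.2 ^ 2)⁻¹ * (t - a.1)) a.1 := by fun_prop
      refine hcts.preimage_mem_nhds ?_
      rwa [sub_self, mul_zero])
    (fun a _ => hKcl.preimage (by fun_prop : Continuous fun t => (a.2 ^ 2)⁻¹ * (t - a.1)))
    (fun s hs e he => by
      obtain ⟨ρ, hρ, hρO⟩ := Metric.isOpen_iff.1 hO s (hJO hs)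
      have hev : ∀ᶠ r : ℝ in 𝓝[>] 0,
          (m * r ^ 2 < min e (min τ ρ)) ∧ (1 + 2 * η) * r < ε ∧ 0 < r := by
        have e1 : Tendsto (fun r : ℝ => m * r ^ 2) (𝓝[>] 0) (𝓝 (m * 0 ^ 2)) :=
          ((by fun_prop : Continuous fun r : ℝ => m * r ^ 2).tendsto 0).mono_left nhdsWithin_le_nhds
        have e2 : Tendsto (fun r : ℝ => (1 + 2 * η) * r) (𝓝[>] 0) (𝓝 ((1 + 2 * η) * 0)) :=
          ((by fun_prop : Continuous fun r : ℝ => (1 + 2 * η) * r).tendsto 0).mono_left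
            nhdsWithin_le_nhds
        have e3 : m * 0 ^ 2 < min e (min τ ρ) := by
          rw [zero_pow two_ne_zero, mul_zero]
          positivity
        have e4 : (1 + 2 * η) * 0 < ε := by rwa [mul_zero]
        exact (e1.eventually_lt_const e3).and
          ((e2.eventually_lt_const e4).and self_mem_nhdsWithin)
      obtain ⟨r, h1, h2, h3⟩ := hev.exists
      simp only [lt_min_iff] at h1
      exact ⟨(s, r), ⟨hs, h3, h1.2.1.le, h2.le,
        (Metric.closedBall_subset_ball h1.2.2).trans hρO⟩, h1.1.le, rfl⟩)
  have hBO : ∀ a ∈ u, B a ⊆ O := fun a ha => (hBball a (huT ha).2.1).trans (huT ha).2.2.2.2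
  have hpiece : ∀ a ∈ u, sphericalPre ε (γ '' B a) ≤
      ENNReal.ofReal ((1 + η) * (1 + 2 * η) ^ 2) * volume (B a) := by
    intro a ha
    obtain ⟨haJ, ha0, haτ, haε, -⟩ := huT ha
    refine (sphericalPre_mono ε (hBimage a ha0 haτ (interior_subset (hJ haJ))
      ((hBO a ha).trans (hOI.trans interior_subset)))).trans
      ((sphericalPre_closedBall_le (by positivity) haε _).trans ?_)
    rw [hBvol a ha0, mul_pow, ENNReal.ofReal_mul (by positivity), ENNReal.ofReal_mul (by positivity)]
    calc betaD * (ENNReal.ofReal ((1 + 2 * η) ^ 2) * ENNReal.ofReal (a.2 ^ 2))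
        ≤ ENNReal.ofReal (1 + η) * volume K *
          (ENNReal.ofReal ((1 + 2 * η) ^ 2) * ENNReal.ofReal (a.2 ^ 2)) := by gcongr
      _ = _ := by ring
  have hnull : sphericalPre ε (γ '' (J \ ⋃ a ∈ u, B a)) ≤ 0 :=
    (sphericalPre_le_sphericalOuter hε _).trans (hγ.sphericalOuter_image_null hd
      (sdiff_subset.trans (hJ.trans interior_subset)) hunull).le
  have hcov : γ '' J ⊆ (⋃ a ∈ u, γ '' B a) ∪ γ '' (J \ ⋃ a ∈ u, B a) := by
    rw [← image_iUnion₂, ← image_union, union_sdiff_self]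
    exact image_mono subset_union_right
  calc sphericalPre ε (γ '' J)
      ≤ sphericalPreOuter ε hε.le ((⋃ a ∈ u, γ '' B a) ∪ γ '' (J \ ⋃ a ∈ u, B a)) :=
        sphericalPre_mono ε hcov
    _ ≤ sphericalPreOuter ε hε.le (⋃ a ∈ u, γ '' B a) +
        sphericalPreOuter ε hε.le (γ '' (J \ ⋃ a ∈ u, B a)) := measure_union_le _ _
    _ ≤ ∑' a : u, sphericalPreOuter ε hε.le (γ '' B a) + 0 :=
        add_le_add (measure_biUnion_le _ hucount _) hnull
    _ ≤ ∑' a : u, ENNReal.ofReal ((1 + η) * (1 + 2 * η) ^ 2) * volume (B a) := by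
        rw [add_zero]
        exact ENNReal.tsum_le_tsum fun a => hpiece a a.2
    _ = ENNReal.ofReal ((1 + η) * (1 + 2 * η) ^ 2) * volume (⋃ a ∈ u, B a) := by
        rw [ENNReal.tsum_mul_left, measure_biUnion hucount hudisj fun a _ =>
          (hKcl.preimage
            (by fun_prop : Continuous fun t => (a.2 ^ 2)⁻¹ * (t - a.1))).measurableSet]
    _ ≤ ENNReal.ofReal ((1 + η) * (1 + 2 * η) ^ 2) * volume O := by
        gcongr
        exact iUnion₂_subset hBO

/-- An injective curve of unit vertical speed is parametrized by arc length with respect to the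
`2`-dimensional spherical measure. -/
theorem HasUnitVerticalSpeed.sphericalOuter_image (hd : IsHomogeneousDistance)
    (hγ : HasUnitVerticalSpeed I γ) (hI : I.OrdConnected) (hcont : ContinuousOn γ I)
    (hinj : InjOn γ I) {J : Set ℝ} (hJ : J ⊆ I) (hJm : MeasurableSet J) :
    sphericalOuter (γ '' J) = volume J := by
  refine le_antisymm ?_ ?_
  · have hnull : volume (J \ interior I) = 0 := measure_mono_null
      (sdiff_subset_sdiff_left (hJ.trans subset_closure)) (hI.convex.addHaar_frontier volume)
    calc sphericalOuter (γ '' J)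
        = sphericalOuter (γ '' (J ∩ interior I) ∪ γ '' (J \ interior I)) := by
          rw [← image_union, inter_union_sdiff]
      _ ≤ sphericalOuter (γ '' (J ∩ interior I)) + sphericalOuter (γ '' (J \ interior I)) :=
          measure_union_le _ _
      _ = sphericalOuter (γ '' (J ∩ interior I)) := by
          rw [hγ.sphericalOuter_image_null hd (sdiff_subset.trans hJ) hnull, add_zero]
      _ ≤ volume (J ∩ interior I) :=
          hγ.sphericalOuter_image_le_of_subset_interior hd inter_subset_right
      _ ≤ volume J := measure_mono inter_subset_left
  · rw [hJm.measure_eq_iSup_isCompact]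
    refine iSup_le fun K => iSup_le fun hKJ => iSup_le fun hK => ?_
    exact (hγ.volume_le_of_isCompact hd hcont hinj hK (hKJ.trans hJ)).trans
      (sphericalOuter.mono (image_mono hKJ))

end AreaFormula

end Heis

/-! ### The area formula for the level set -/

theorem corollary7p2
    [MetricSpace Heis] [MeasurableSpace Heis] [BorelSpace Heis]
    (hd : Heis.IsHomogeneousDistance)
    (α : ℝ) (hα0 : 0 < α) (hα1 : α ≤ 1)
    (F : Heis → EuclideanSpace ℝ (Fin 2)) (hF : Heis.IsC1Holder α F)
    (p : Heis) (hp : Heis.IsNondegenerate F p) :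
    ∃ ε₀ : ℝ, 0 < ε₀ ∧
      ∀ (I : Set ℝ) (γ : ℝ → Heis) (q : Heis),
        I.OrdConnected → 0 ∈ I → Heis.IsLSDESolution α F p I γ → Set.InjOn γ I → γ 0 = q →
        (∀ t ∈ I, dist p (γ t) < ε₀) →
        -- arc length parametrization, for every relatively closed subset of the interval
        (∀ J : Set ℝ, J ⊆ I → (∃ C : Set ℝ, IsClosed C ∧ J = I ∩ C) →
          Heis.sphericalOuter (γ '' J) = volume J) ∧
        -- area formula for the level set through `q`, in an open or closed ball centered at `p`
        (∀ (ε : ℝ) (B : Set Heis), 0 < ε → (B = Metric.ball p ε ∨ B = Metric.closedBall p ε) →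
          γ '' I ∩ B = F ⁻¹' {F q} ∩ B →
          (∀ U : Set Heis, U ⊆ B → MeasurableSet U →
            Heis.sphericalOuter (F ⁻¹' {F q} ∩ U) =
              ∫⁻ τ in I, U.indicator (fun _ => (1 : ℝ≥0∞)) (γ τ)) ∧
          (∀ u : Heis → ℝ, Measurable (B.domRestrict u) → (∃ C : ℝ, ∀ x ∈ B, |u x| ≤ C) →
            IntegrableOn u (F ⁻¹' {F q} ∩ B) Heis.sphericalMeasure ∧
            IntegrableOn (fun τ => u (γ τ)) (I ∩ γ ⁻¹' B) volume ∧
            ∫ x in F ⁻¹' {F q} ∩ B, u x ∂Heis.sphericalMeasure =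
              ∫ τ in I ∩ γ ⁻¹' B, u (γ τ))) := by
  obtain ⟨ε₀, C, hε₀, hC, hlev⟩ := Heis.exists_level_estimates hd hα0 hF hp
  refine ⟨ε₀, hε₀, fun I γ q hI _ hγ hinj _ hnear => ?_⟩
  have hest := fun s (hs : s ∈ I) t (ht : t ∈ I) =>
    hlev (γ s) (γ t) (hnear s hs) (hnear t ht) (hγ.eq_of_mem hp hs ht)
  have hspeed := hγ.hasUnitVerticalSpeed hd hα0 hC
    fun s hs t ht => ⟨(hest s hs t ht).1, (hest s hs t ht).2.1⟩
  have hbdd := hγ.isBounded hd hα0 hI (fun s hs t ht => (hest s hs t ht).2.2) hnear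
  have hIm : MeasurableSet I := hI.measurableSet
  have himage := fun {J : Set ℝ} (hJ : J ⊆ I) (hJm : MeasurableSet J) =>
    hspeed.sphericalOuter_image hd hI hγ.continuousOn hinj hJ hJm
  refine ⟨?_, fun ε B _ hB hlevel => ?_⟩
  · rintro J hJ ⟨D, hD, rfl⟩
    exact himage hJ (hIm.inter hD.measurableSet)
  have hpre : ∀ U : Set Heis, MeasurableSet U → MeasurableSet (I ∩ γ ⁻¹' U) := fun U hU => by
    obtain ⟨g, hg, hgγ⟩ : ∃ g : ℝ → Heis, Measurable g ∧ EqOn γ g I := by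
      classical
      exact ⟨I.piecewise γ fun _ => 1, hγ.continuousOn.measurable_piecewise continuousOn_const hIm,
        fun t ht => (piecewise_eq_of_mem _ _ _ ht).symm⟩
    have : I ∩ γ ⁻¹' U = I ∩ g ⁻¹' U := by
      ext t
      refine and_congr_right fun ht => ?_
      rw [mem_preimage, mem_preimage, hgγ ht]
    rw [this]
    exact hIm.inter (hg hU)
  have hmeas : ∀ U : Set Heis, U ⊆ B → MeasurableSet U →
      Heis.sphericalOuter (F ⁻¹' {F q} ∩ U) = volume (I ∩ γ ⁻¹' U) := by
    intro U hUB hU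
    have h1 : F ⁻¹' {F q} ∩ U = γ '' (I ∩ γ ⁻¹' U) := by
      rw [image_inter_preimage, ← inter_eq_self_of_subset_right hUB, ← inter_assoc, ← hlevel,
        inter_assoc]
    rw [h1]
    exact himage inter_subset_left (hpre U hU)
  have hBm : MeasurableSet B := by
    rcases hB with rfl | rfl
    · exact measurableSet_ball
    · exact measurableSet_closedBall
  refine ⟨fun U hUB hU => ?_, fun u hu hub => ?_⟩
  · rw [hmeas U hUB hU]
    have h2 : NullMeasurableSet (γ ⁻¹' U) (volume.restrict I) :=
      (hγ.continuousOn.aemeasurable hIm).nullMeasurableSet_preimage hU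
    change _ = ∫⁻ τ in I, (γ ⁻¹' U).indicator 1 τ
    rw [lintegral_indicator_one₀ h2, Measure.restrict_apply₀' hIm.nullMeasurableSet, inter_comm]
  have hlm : MeasurableSet (F ⁻¹' {F q}) :=
    (isClosed_singleton.preimage (hF.continuous hd hα0)).measurableSet
  -- The spherical measure on the level set is the image of the Lebesgue measure.
  have hγae : AEMeasurable γ (volume.restrict (I ∩ γ ⁻¹' B)) :=
    (hγ.continuousOn.aemeasurable hIm).mono_measure (Measure.restrict_mono inter_subset_left le_rfl)
  have hmap : (volume.restrict (I ∩ γ ⁻¹' B)).map γ =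
      Heis.sphericalMeasure.restrict (F ⁻¹' {F q} ∩ B) := by
    ext U hU
    rw [Measure.map_apply_of_aemeasurable hγae hU, Measure.restrict_apply hU,
      Measure.restrict_apply₀' (hpre B hBm).nullMeasurableSet, Heis.sphericalMeasure,
      toMeasure_apply _ _ (hU.inter (hlm.inter hBm))]
    rw [show U ∩ (F ⁻¹' {F q} ∩ B) = F ⁻¹' {F q} ∩ (U ∩ B) by
      rw [inter_left_comm], hmeas _ inter_subset_right (hU.inter hBm)]
    congr 1
    rw [preimage_inter, inter_left_comm]
  have hfinite : volume (I ∩ γ ⁻¹' B) < ⊤ :=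
    (measure_mono inter_subset_left).trans_lt hbdd.measure_lt_top
  have huae : AEMeasurable u (Heis.sphericalMeasure.restrict (F ⁻¹' {F q} ∩ B)) :=
    (aemeasurable_restrict_of_measurable_subtype hBm hu).mono_measure
      (Measure.restrict_mono inter_subset_right le_rfl)
  have huγ : AEStronglyMeasurable u ((volume.restrict (I ∩ γ ⁻¹' B)).map γ) := by
    rw [hmap]
    exact huae.aestronglyMeasurable
  have hint : IntegrableOn (fun τ => u (γ τ)) (I ∩ γ ⁻¹' B) volume := by
    obtain ⟨D, hD⟩ := hub
    refine IntegrableOn.of_bound hfinite (huγ.comp_aemeasurable hγae) D ?_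
    exact (ae_restrict_mem (hpre B hBm)).mono fun τ hτ => hD _ hτ.2
  refine ⟨?_, hint, ?_⟩
  · rw [IntegrableOn, ← hmap]
    exact (integrable_map_measure huγ hγae).2 hint
  · rw [← hmap]
    exact integral_map hγae huγ
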